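/- Let $T$ be a compact metric space, $\mathbb{C}=C(T,\mathbb{R})$ with the sup norm, and $\mathbb{C}_0\subset\mathbb{C}$ the set of non-negative, not identically zero functions, both with their Borel $\sigma$-algebras. A sample continuous random field $\eta$ on $T$ is *simple max-stable* if $\mathbb{P}[\eta(t)\le x]=e^{-1/x}1_{\{x>0\}}$ for all $t\in T$, $x\in\mathbb{R}$, and if, for every $n\ge 1$, $\eta$ has the law of $n^{-1}\bigvee_{i=1}^n\eta_i$ with $\eta_1,\dots,\eta_n$ i.i.d. copies of $\eta$. Let $\sigma$ be a probability measure on $\mathbb{C}_0$ with $\int f(t)\,\sigma(df)=1$ for all $t\in T$ and $\int\|f\|\,\sigma(df)<\infty$, and put $$\mu(A)=\int_0^\infty\int_{\mathbb{C}_0}1_{\{rf\in A\}}\,\sigma(df)\,r^{-2}dr,\qquad A\subset\mathbb{C}_0\text{ Borel}.$$ Let $\eta$ be a continuous simple max-stable random field with spectral measure $\sigma$: on the same probability space as $\eta$ there is a Poisson random measure $\Phi$ on $\mathbb{C}_0$ with intensity $\mu$, almost surely a point measure with finitely many points in $\{\|f\|>\varepsilon\}$ for each $\varepsilon>0$, such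 that almost surely $\eta(s)=\max\{f(s):f\text{ atom of }\Phi\}$ for all $s\in T$. Let $t\in T$. Then: 1. The restriction of $\Phi$ to $\{f: f(t)\ge\eta(t)\}$ is almost surely a Dirac mass $\delta_{\phi_t^+}$ for some $\mathbb{C}_0$-valued random variable $\phi_t^+$ (the $t$-extremal function). There is a probability kernel $P_t(y,df)$, $y>0$, which is a regular version of the conditional measure $\mu(df)$ given $f(t)=y$, that is, $\int F(f(t),f)\,\mu(df)=\int_{(0,\infty)}\int_{\mathbb{C}_0}F(y,f)\,P_t(y,df)\,\mu_t(dy)$ for each measurable $F\ge 0$ on $[0,\infty)\times\mathbb{C}_0$ vanishing on $\{0\}\times\mathbb{C}_0$, where $\mu_t$ is the restriction to $(0,\infty)$ of the image of $\mu$ under $f\mapsto f(t)$. 2. For any such $\phi_t^+$ and $P_t$, for almost every $y$ with respect to the law of $\eta(t)$, the regular conditional distribution of $\phi_t^+$ given $\eta(t)=y$ is $$\mathbb{P}[\phi_t^+\in A\mid\eta(t)=y]=P_t(y,A)=\int_{\mathbb{C}_0}1_{\{\frac{y}{f(t)}f\in A\}}\,f(t)\,\sigma(df)\qquad\text{for all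 Borel }A\subset\mathbb{C}_0.$$ 3. For almost every $y$ with respect to the law of $\eta(t)$, the regular conditional distribution of $\eta$ given $\eta(t)=y$ satisfies, for all $l\ge 1$, $\mathbf{s}=(s_1,\dots,s_l)\in T^l$ and $\mathbf{z}=(z_1,\dots,z_l)\in[0,\infty)^l$, $$\mathbb{P}[\eta(s_i)<z_i,\ 1\le i\le l\mid\eta(t)=y]=\exp\Big[-\int_{\mathbb{C}_0}\Big(\bigvee_{i=1}^l\frac{f(s_i)}{z_i}-\frac{f(t)}{y}\Big)^+\sigma(df)\Big]\int_{\mathbb{C}_0}1_{\{\bigvee_{i=1}^l\frac{f(s_i)}{z_i}<\frac{f(t)}{y}\}}\,f(t)\,\sigma(df),$$ with $(x)^+=\max(x,0)$ and the conventions $a/0=\infty$ for $a>0$, $0/0=0$, $e^{-\infty}=0$. -/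

import Mathlib

open MeasureTheory ProbabilityTheory
open scoped ENNReal NNReal

noncomputable section

/-! ### The spaces of continuous functions, and point measures on them -/

/-- Continuous functions carry the Borel `σ`-algebra (of the sup norm when the domain is compact). -/
instance instMeasurableSpaceContinuousMapReal {T : Type*} [TopologicalSpace T] :
    MeasurableSpace C(T, ℝ) := borel _

instance instBorelSpaceContinuousMapReal {T : Type*} [TopologicalSpace T] :
    BorelSpace C(T, ℝ) := ⟨rfl⟩

/-- The space `ℂ₀` of non-negative, non-null continuous functions, as a subspace of `C(T, ℝ)`. -/
abbrev PosFun (T : Type*) [TopologicalSpace T] : Type _ :=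
  {f : C(T, ℝ) // 0 ≤ f ∧ f ≠ 0}

instance instNonemptyPosFun {T : Type*} [TopologicalSpace T] [Nonempty T] :
    Nonempty (PosFun T) := ⟨⟨1, zero_le_one, one_ne_zero⟩⟩

theorem measurableSet_posFun (T : Type*) [MetricSpace T] [CompactSpace T] :
    MeasurableSet {f : C(T, ℝ) | 0 ≤ f ∧ f ≠ 0} := by
  have h0 : IsClosed {f : C(T, ℝ) | 0 ≤ f} := by
    have : {f : C(T, ℝ) | 0 ≤ f} = ⋂ s : T, {f : C(T, ℝ) | 0 ≤ f s} := by
      ext f; simp [ContinuousMap.le_def]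
    rw [this]
    exact isClosed_iInter fun s => isClosed_le continuous_const (by fun_prop)
  exact h0.measurableSet.inter (measurableSet_singleton (0 : C(T, ℝ))).compl

instance instStandardBorelPosFun {T : Type*} [MetricSpace T] [CompactSpace T] :
    StandardBorelSpace (PosFun T) := (measurableSet_posFun T).standardBorel

/-- `M` is a point measure `∑ᵢ δ_{fᵢ}` on `ℂ₀` with only finitely many points (counted with
multiplicity) of norm larger than `ε`, for each `ε > 0`: the elements of `M_p(ℂ₀)`.
The `σ`-algebra on measures is Mathlib's, generated by the evaluations `M ↦ M A`. -/
def IsPointMeasure {T : Type*} [MetricSpace T] [CompactSpace T]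
    (M : Measure (PosFun T)) : Prop :=
  ∃ (ι : Type) (f : ι → PosFun T),
    M = Measure.sum (fun i => Measure.dirac (f i)) ∧
      ∀ ε : ℝ, 0 < ε → {i | ε < ‖(f i).1‖}.Finite

/-- The pointwise maximum `max(M)(s) = max {f(s) ; f atom of M}`, with value `0` if there is no
atom (which is the value of a supremum over the empty set in `ℝ`). -/
def pointMax {T : Type*} [TopologicalSpace T] (M : Measure (PosFun T)) (s : T) : ℝ :=
  ⨆ f : {f : PosFun T // M {f} ≠ 0}, f.1.1 s

/-- The `K`-extremal part of `M`: the restriction of `M` to the functions `f` which do not satisfy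
`f < max(M)` everywhere on `K`. -/
def extremalPart {T : Type*} [TopologicalSpace T] (K : Set T) (M : Measure (PosFun T)) :
    Measure (PosFun T) :=
  M.restrict {f | ¬ ∀ s ∈ K, f.1 s < pointMax M s}

/-! ### Poisson random measures -/

/-- `Φ` is a Poisson random measure with intensity `μ` on the probability space `(Ω, P)`. -/
structure IsPoissonRandomMeasure {Ω E : Type*} [MeasurableSpace Ω] [MeasurableSpace E]
    (Φ : Ω → Measure E) (μ : Measure E) (P : Measure Ω) : Prop where
  measurable : Measurable Φ
  poisson : ∀ A, MeasurableSet A → μ A ≠ ∞ →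
    P.map (fun ω => Φ ω A) = (poissonMeasure (μ A).toNNReal).map (fun n : ℕ => (n : ℝ≥0∞))
  infinite : ∀ A, MeasurableSet A → μ A = ∞ → ∀ᵐ ω ∂P, Φ ω A = ∞
  indep : ∀ (n : ℕ) (A : Fin n → Set E), (∀ i, MeasurableSet (A i)) →
    Pairwise (fun i j => Disjoint (A i) (A j)) → iIndepFun (fun i ω => Φ ω (A i)) P

/-! ### Simple max-stable random fields -/

/-- A sample continuous random field `η` is simple max-stable: it has standard unit Fréchet
margins, and `η` has the law of `n⁻¹ max (η₁, …, ηₙ)` where `η₁, …, ηₙ` are i.i.d. copies of `η`,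
for each `n ≥ 1` (written as `n + 1` below). -/
structure IsSimpleMaxStable {T Ω : Type*} [MetricSpace T] [CompactSpace T] [MeasurableSpace Ω]
    (η : Ω → C(T, ℝ)) (P : Measure Ω) : Prop where
  measurable : Measurable η
  frechet : ∀ (t : T) (x : ℝ),
    P {ω | η ω t ≤ x} = if 0 < x then ENNReal.ofReal (Real.exp (-x⁻¹)) else 0
  maxStable : ∀ n : ℕ,
    P.map η = (Measure.pi (fun _ : Fin (n + 1) => P.map η)).map
      (fun g => ((n + 1 : ℕ) : ℝ)⁻¹ • Finset.univ.sup' Finset.univ_nonempty g)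

/-- The function `c f` for `c > 0`. (For `c ≤ 0`, where `c f` is not in `ℂ₀`, the value is `f`
by convention; it never matters.) -/
def PosFun.scale {T : Type*} [TopologicalSpace T] (c : ℝ) (f : PosFun T) : PosFun T :=
  if h : 0 < c then ⟨c • f.1, smul_nonneg h.le f.2.1, smul_ne_zero h.ne' f.2.2⟩ else f

theorem PosFun.measurable_scale {T : Type*} [MetricSpace T] [CompactSpace T] :
    Measurable (fun p : ℝ × PosFun T => PosFun.scale p.1 p.2) := by
  have h : Measurable (fun p : ℝ × PosFun T =>
      if 0 < p.1 then p.1 • (p.2 : C(T, ℝ)) else (p.2 : C(T, ℝ))) := by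
    refine Measurable.ite (measurableSet_lt measurable_const measurable_fst) ?_ ?_
    · exact (show Continuous (fun p : ℝ × C(T, ℝ) => p.1 • p.2) by fun_prop).measurable.comp
        (measurable_fst.prodMk (measurable_subtype_coe.comp measurable_snd))
    · exact measurable_subtype_coe.comp measurable_snd
  have h' : Measurable (fun p : ℝ × PosFun T => (PosFun.scale p.1 p.2 : C(T, ℝ))) := by
    convert h using 2 with p
    unfold PosFun.scale
    split_ifs <;> rfl
  exact h'.subtype_mk (h := fun p => (PosFun.scale p.1 p.2).2)

/-- The measure `μ(A) = ∫₀^∞ ∫ 1{r f ∈ A} σ(df) r⁻² dr` on `ℂ₀`. -/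
def exponentMeasure {T : Type*} [MetricSpace T] [CompactSpace T] (σ : Measure (PosFun T)) :
    Measure (PosFun T) :=
  ((((volume : Measure ℝ).restrict (Set.Ioi 0)).withDensity
      (fun r => ENNReal.ofReal ((r ^ 2)⁻¹))).prod σ).map (fun p => PosFun.scale p.1 p.2)

/-- The requirements on a spectral measure `σ`, as the law of a process `Y` with values in `ℂ₀`:
`E[Y(t)] = 1` for all `t`, and `E‖Y‖ < ∞`. -/
structure IsSpectralMeasure {T : Type*} [MetricSpace T] [CompactSpace T]
    (σ : Measure (PosFun T)) : Prop where
  prob : IsProbabilityMeasure σ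
  mean_eq_one : ∀ t : T, ∫ f, f.1 t ∂σ = 1
  integrable_norm : Integrable (fun f : PosFun T => ‖f.1‖) σ

/-- `η` is a continuous simple max-stable random field with spectral measure `σ`, and
`Φ` is a Poisson random measure in `M_p(ℂ₀)`, with the exponent measure associated to `σ` as
intensity, on the same probability space and such that `η = max(Φ)` almost surely. -/
structure IsMaxStableFieldWith {T Ω : Type*} [MetricSpace T] [CompactSpace T] [MeasurableSpace Ω]
    (η : Ω → C(T, ℝ)) (σ : Measure (PosFun T)) (Φ : Ω → Measure (PosFun T)) (P : Measure Ω) :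
    Prop where
  simpleMaxStable : IsSimpleMaxStable η P
  spectral : IsSpectralMeasure σ
  poisson : IsPoissonRandomMeasure Φ (exponentMeasure σ) P
  pointMeasure : ∀ᵐ ω ∂P, IsPointMeasure (Φ ω)
  eq_max : ∀ᵐ ω ∂P, ∀ s : T, η ω s = pointMax (Φ ω) s

/-- `φ` is the `t`-extremal function of `Φ`: the `{t}`-extremal part of `Φ` is almost surely the
Dirac mass at `φ`. -/
structure IsExtremalFunction {T Ω : Type*} [TopologicalSpace T] [MeasurableSpace Ω]
    (φ : Ω → PosFun T) (Φ : Ω → Measure (PosFun T)) (t : T) (P : Measure Ω) : Prop where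
  aemeasurable : AEMeasurable φ P
  extremalPart_eq : ∀ᵐ ω ∂P, extremalPart {t} (Φ ω) = Measure.dirac (φ ω)

/-- The measure `μ_t` on `(0, ∞)`, image of `μ` under `f ↦ f(t)` (seen as a measure on `ℝ`). -/
def marginal {T : Type*} [TopologicalSpace T] (μ : Measure (PosFun T)) (t : T) : Measure ℝ :=
  (μ.map (fun f => f.1 t)).restrict (Set.Ioi 0)

/-- The probability kernel `κ(x, df)` is a regular version of the conditional measure `μ(df)`
given `f(t) = x`, `x > 0`: for each measurable `F ≥ 0` vanishing on `{0} × ℂ₀`,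
`∫ F(f(t), f) μ(df) = ∫ ∫ F(x, f) κ(x, df) μ_t(dx)`. -/
structure IsConditionalMeasure {T : Type*} [TopologicalSpace T] (κ : Kernel ℝ (PosFun T))
    (μ : Measure (PosFun T)) (t : T) : Prop where
  prob : IsMarkovKernel κ
  disintegrate : ∀ F : ℝ × PosFun T → ℝ≥0∞, Measurable F → (∀ f, F (0, f) = 0) →
    ∫⁻ f, F (f.1 t, f) ∂μ = ∫⁻ x, ∫⁻ f, F (x, f) ∂(κ x) ∂(marginal μ t)

end

/-! Two facts carry the theorem. The first is the disintegration of the exponent measure `μ` along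
`f ↦ f(t)`. Substituting `y = r f(t)` in `∫∫ F(r f(t), r f) r⁻² dr σ(df)` turns `r⁻² dr` into `f(t)
y⁻² dy`. Hence `μ_t` is `y⁻² dy`, and the conditional measure given `f(t) = y` is the law of `(y /
f(t)) f` under `f(t) σ(df)` (`lintegral_exponentMeasure_disintegrate`).

The second is a formula of Mecke type for the extremal function `φ`
(`measure_extremal_mem_and_eq_zero`): `P[φ ∈ A \ D, Φ(D) = 0]` is the integral over `f ∈ A \ D` of
`exp(-μ(D ∪ {g : g(t) ≥ f(t)})) μ(df)`. It is proved from the definition of a Poisson random measure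
by discretising values at `t`. If exactly one point lies in `V = D ∪ {f(t) ≥ a}`, and it lies in a
slice `S ⊆ V` of `A \ D`, the event has probability `e^{-μ(V)} μ(S)`. Summing over a grid of slices
gives a Riemann sum, which converges as the mesh shrinks. For `A` everything and `D` empty the limit
is `∫ e^{-1/y} y⁻² dy = 1`, so the grid almost surely isolates a unique maximiser at `t`; this gives
the existence of `φ` and makes the discretised events exact in the limit.

With `D` empty, the formula and the disintegration give the joint law of `(η(t), φ)`, hence part 2.
For part 3, the event that `η` stays below prescribed levels on prescribed sets is a void event
`Φ(D) = 0`. The exponential factors as `exp(-μ(D ∩ {f(t) < y})) e^{-1/y}`, the last factor being the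
density of `η(t)` with respect to `y⁻² dy`, so it cancels under conditioning
(`condDistrib_apply_ae_eq`). Countably many boxes share one null set, and monotone limits recover
every finite dimensional distribution function (`measure_lt_eq_of_boundedOn`). -/

noncomputable section

/-! ### The measure `r⁻² dr` on the positive half-line -/

/-- The measure `r⁻² dr` on `(0, ∞)`. -/
def invSqMeasure : Measure ℝ :=
  ((volume : Measure ℝ).restrict (Set.Ioi 0)).withDensity (fun r => ENNReal.ofReal ((r ^ 2)⁻¹))

instance : SFinite invSqMeasure := by unfold invSqMeasure; infer_instance

theorem lintegral_invSqMeasure {G : ℝ → ℝ≥0∞} (hG : Measurable G) :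
    ∫⁻ r, G r ∂invSqMeasure = ∫⁻ r in Set.Ioi 0, ENNReal.ofReal ((r ^ 2)⁻¹) * G r := by
  rw [invSqMeasure, lintegral_withDensity_eq_lintegral_mul _ (by fun_prop) hG]
  rfl

theorem ae_pos_invSqMeasure : ∀ᵐ r ∂invSqMeasure, 0 < r :=
  (withDensity_absolutelyContinuous _ _).ae_le (ae_restrict_mem measurableSet_Ioi)

/-- Homogeneity of degree `-1`: under `y = r c` the measure `r⁻² dr` becomes `c y⁻² dy`. This factor
`c` is the origin of the density `f(t)` in `f(t) σ(df)`. -/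
theorem lintegral_invSqMeasure_comp_mul {c : ℝ} (hc : 0 < c) {G : ℝ → ℝ≥0∞} (hG : Measurable G) :
    ∫⁻ r, G (r * c) ∂invSqMeasure = ENNReal.ofReal c * ∫⁻ y, G y ∂invSqMeasure := by
  rw [lintegral_invSqMeasure hG, lintegral_invSqMeasure (by fun_prop),
    ← lintegral_indicator measurableSet_Ioi, ← lintegral_indicator measurableSet_Ioi]
  set H : ℝ → ℝ≥0∞ := (Set.Ioi 0).indicator (fun r => ENNReal.ofReal ((r ^ 2)⁻¹) * G r) with hH
  have hHm : Measurable H := Measurable.indicator (by fun_prop) measurableSet_Ioi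
  have h1 : ∀ r : ℝ, (Set.Ioi (0 : ℝ)).indicator
      (fun r => ENNReal.ofReal ((r ^ 2)⁻¹) * G (r * c)) r =
      ENNReal.ofReal (c ^ 2) * H (c * r) := by
    intro r
    by_cases hr : 0 < r
    · have : 0 < c * r := by positivity
      rw [hH, Set.indicator_of_mem (by exact hr), Set.indicator_of_mem (by exact this), ← mul_assoc,
        ← ENNReal.ofReal_mul (by positivity), mul_comm c r]
      congr 2
      field_simp
    · have : ¬ 0 < c * r := by
        rw [mul_pos_iff_of_pos_left hc]; exact hr
      rw [hH, Set.indicator_of_notMem (by exact hr), Set.indicator_of_notMem (by exact this),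
        mul_zero]
  simp_rw [h1]
  rw [lintegral_const_mul _ (by fun_prop), ← lintegral_map hHm (by fun_prop),
    Real.map_volume_mul_left hc.ne', lintegral_smul_measure, smul_eq_mul, ← mul_assoc,
    ← ENNReal.ofReal_mul (by positivity), abs_of_pos (by positivity)]
  congr 2
  field_simp

theorem invSqMeasure_Ici {a : ℝ} (ha : 0 < a) :
    invSqMeasure (Set.Ici a) = ENNReal.ofReal a⁻¹ := by
  have h1 : invSqMeasure (Set.Ici a) = ∫⁻ r in Set.Ioi a, ENNReal.ofReal (r ^ (-2 : ℝ)) := by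
    rw [invSqMeasure, withDensity_apply _ measurableSet_Ici,
      Measure.restrict_restrict measurableSet_Ici,
      Set.inter_eq_left.2 (Set.Ici_subset_Ioi.2 ha),
      Measure.restrict_congr_set Ioi_ae_eq_Ici.symm]
    refine setLIntegral_congr_fun measurableSet_Ioi (fun x hx => ?_)
    have : 0 < x := ha.trans hx
    simp [Real.rpow_neg this.le]
  rw [h1, ← ofReal_integral_eq_lintegral_ofReal (integrableOn_Ioi_rpow_of_lt (by norm_num) ha),
    integral_Ioi_rpow_of_lt (by norm_num) ha]
  · congr 1
    norm_num [Real.rpow_neg ha.le]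
  · filter_upwards [ae_restrict_mem measurableSet_Ioi] with x hx
    exact Real.rpow_nonneg (ha.trans hx).le _

/-- The mass under `r⁻² dr` of the `r` with `1 / c ≤ r`. -/
theorem invSqMeasure_one_le_mul {c : ℝ≥0∞} (hc : c ≠ ∞) :
    invSqMeasure {r | 1 ≤ ENNReal.ofReal r * c} = c := by
  rcases eq_or_ne c 0 with rfl | hc0
  · simp
  have hpos : 0 < c.toReal := ENNReal.toReal_pos hc0 hc
  have : {r | 1 ≤ ENNReal.ofReal r * c} = Set.Ici (c.toReal⁻¹) := by
    ext r
    rw [Set.mem_ofPred_eq, Set.mem_Ici, ← ENNReal.ofReal_toReal hc, ENNReal.toReal_ofReal hpos.le,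
      ← ENNReal.ofReal_mul' hpos.le, ENNReal.one_le_ofReal, inv_le_iff_one_le_mul₀ hpos]
  rw [this, invSqMeasure_Ici (by positivity), inv_inv, ENNReal.ofReal_toReal hc]

theorem measurableSet_one_le_mul (c : ℝ≥0∞) : MeasurableSet {r | 1 ≤ ENNReal.ofReal r * c} :=
  measurableSet_le measurable_const (by fun_prop)

/-- A difference of two nested half-lines, empty when `c ≤ d`; truncated subtraction covers both
cases. This produces the positive part in the final formula. -/
theorem invSqMeasure_one_le_mul_and_mul_lt {c d : ℝ≥0∞} (hc : c ≠ ∞) (hd : d ≠ ∞) :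
    invSqMeasure {r | 1 ≤ ENNReal.ofReal r * c ∧ ENNReal.ofReal r * d < 1} = c - d := by
  have h : {r | 1 ≤ ENNReal.ofReal r * c ∧ ENNReal.ofReal r * d < 1} =
      {r | 1 ≤ ENNReal.ofReal r * c} \ {r | 1 ≤ ENNReal.ofReal r * d} := by
    ext r; simp
  rcases le_total d c with hdc | hcd
  · have hsub : {r | 1 ≤ ENNReal.ofReal r * d} ⊆ {r | 1 ≤ ENNReal.ofReal r * c} :=
      Set.ofPred_subset_ofPred.2 fun r hr => hr.trans (by gcongr)
    rw [h, measure_sdiff hsub (measurableSet_one_le_mul d).nullMeasurableSet,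
      invSqMeasure_one_le_mul hc, invSqMeasure_one_le_mul hd]
    rwa [invSqMeasure_one_le_mul hd]
  · have hsub : {r | 1 ≤ ENNReal.ofReal r * c} ⊆ {r | 1 ≤ ENNReal.ofReal r * d} :=
      Set.ofPred_subset_ofPred.2 fun r hr => hr.trans (by gcongr)
    rw [h, Set.sdiff_eq_empty.2 hsub, measure_empty, tsub_eq_zero_of_le hcd]

/-! ### The exponential `e^{-x}` of an extended non-negative number -/

/-- The function `e^{-x}` for `x ∈ [0, ∞]`, with `e^{-∞} = 0`. -/
abbrev expNeg (x : ℝ≥0∞) : ℝ≥0∞ := EReal.exp (-(x : EReal))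

theorem expNeg_antitone : Antitone expNeg := fun x y h =>
  EReal.exp_monotone (EReal.neg_le_neg_iff.2 (by exact_mod_cast h))

theorem measurable_expNeg : Measurable expNeg := expNeg_antitone.measurable

theorem expNeg_add (x y : ℝ≥0∞) : expNeg (x + y) = expNeg x * expNeg y := by
  rw [expNeg, expNeg, expNeg, ← EReal.exp_add]
  congr 1
  rw [EReal.coe_ennreal_add, EReal.neg_add (by simp) (by simp), sub_eq_add_neg]

theorem expNeg_of_ne_top {x : ℝ≥0∞} (hx : x ≠ ∞) :
    expNeg x = ENNReal.ofReal (Real.exp (-x.toReal)) := by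
  lift x to ℝ≥0 using hx
  rw [expNeg, ← EReal.exp_coe]
  rfl

theorem expNeg_top : expNeg ∞ = 0 := by simp [expNeg]

theorem expNeg_zero : expNeg 0 = 1 := by simp [expNeg]

theorem expNeg_ne_top (x : ℝ≥0∞) : expNeg x ≠ ∞ := by simp [expNeg]

theorem tendsto_expNeg {ι : Type*} {l : Filter ι} {u : ι → ℝ≥0∞} {x : ℝ≥0∞} (hx : x ≠ ∞)
    (h : Filter.Tendsto u l (nhds x)) :
    Filter.Tendsto (fun i => expNeg (u i)) l (nhds (expNeg x)) := by
  rw [expNeg_of_ne_top hx]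
  have h1 : Filter.Tendsto (fun i => ENNReal.ofReal (Real.exp (-(u i).toReal))) l
      (nhds (ENNReal.ofReal (Real.exp (-x.toReal)))) :=
    (ENNReal.continuous_ofReal.tendsto _).comp ((Real.continuous_exp.tendsto _).comp
      ((ENNReal.tendsto_toReal hx).comp h).neg)
  refine h1.congr' ?_
  filter_upwards [h.eventually (gt_mem_nhds (lt_top_iff_ne_top.2 hx))] with i hi
  rw [expNeg_of_ne_top hi.ne]

theorem lintegral_expNeg_inv :
    ∫⁻ x, expNeg (ENNReal.ofReal x⁻¹) ∂invSqMeasure = 1 := by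
  -- The antiderivative of `x⁻² e^{-1/x}` is `e^{-1/x}`; `expNegInvGlue` extends it continuously by
  -- `0` at the origin, so the fundamental theorem applies on the whole half-line.
  have hpos : ∀ x : ℝ, 0 < x → expNegInvGlue x = Real.exp (-x⁻¹) := fun x hx => by
    simp [expNegInvGlue, hx.not_ge]
  have hderiv : ∀ x ∈ Set.Ioi (0 : ℝ),
      HasDerivAt expNegInvGlue ((x ^ 2)⁻¹ * Real.exp (-x⁻¹)) x := by
    intro x hx
    have h1 : HasDerivAt (fun x : ℝ => Real.exp (-x⁻¹)) ((x ^ 2)⁻¹ * Real.exp (-x⁻¹)) x := by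
      have := (hasDerivAt_inv (ne_of_gt hx)).fun_neg.exp
      rwa [neg_neg, mul_comm] at this
    exact h1.congr_of_eventuallyEq (Filter.eventuallyEq_of_mem (Ioi_mem_nhds hx) hpos)
  have hcont : ContinuousWithinAt expNegInvGlue (Set.Ici 0) 0 :=
    (expNegInvGlue.contDiff (n := 0)).continuous.continuousWithinAt
  have hlim : Filter.Tendsto expNegInvGlue Filter.atTop (nhds 1) := by
    have : Filter.Tendsto (fun x : ℝ => Real.exp (-x⁻¹)) Filter.atTop (nhds (Real.exp (-0))) :=
      (Real.continuous_exp.tendsto _).comp tendsto_inv_atTop_zero.neg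
    rw [neg_zero, Real.exp_zero] at this
    exact this.congr' ((Filter.eventually_gt_atTop 0).mono fun x hx => (hpos x hx).symm)
  have hnn : ∀ x ∈ Set.Ioi (0 : ℝ), 0 ≤ (x ^ 2)⁻¹ * Real.exp (-x⁻¹) := fun x _ => by positivity
  have hint := integrableOn_Ioi_deriv_of_nonneg hcont hderiv hnn hlim
  have hval := integral_Ioi_of_hasDerivAt_of_tendsto hcont hderiv hint hlim
  rw [lintegral_invSqMeasure (G := fun x => expNeg (ENNReal.ofReal x⁻¹))
    (measurable_expNeg.comp (by fun_prop))]
  rw [expNegInvGlue.zero, sub_zero] at hval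
  rw [← ENNReal.ofReal_one, ← hval, ofReal_integral_eq_lintegral_ofReal hint
    ((ae_restrict_mem measurableSet_Ioi).mono hnn)]
  refine setLIntegral_congr_fun measurableSet_Ioi (fun x hx => ?_)
  have hx' : (0 : ℝ) < x := hx
  rw [expNeg_of_ne_top ENNReal.ofReal_ne_top, ENNReal.toReal_ofReal (by positivity),
    ENNReal.ofReal_mul (by positivity)]

/-! ### The exponent measure and its disintegration -/

section Exponent

variable {T : Type*} [MetricSpace T]

theorem PosFun.measurable_eval (t : T) : Measurable (fun f : PosFun T => f.1 t) :=
  (show Continuous (fun f : PosFun T => f.1 t) by fun_prop).measurable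

theorem PosFun.apply_nonneg (f : PosFun T) (t : T) : 0 ≤ f.1 t := f.2.1 t

theorem PosFun.scale_apply {c : ℝ} (hc : 0 < c) (f : PosFun T) (t : T) :
    (PosFun.scale c f).1 t = c * f.1 t := by
  simp [PosFun.scale, hc]

variable [CompactSpace T]

theorem lintegral_exponentMeasure (σ : Measure (PosFun T)) [SFinite σ] {F : PosFun T → ℝ≥0∞}
    (hF : Measurable F) :
    ∫⁻ f, F f ∂(exponentMeasure σ) = ∫⁻ f, ∫⁻ r, F (PosFun.scale r f) ∂invSqMeasure ∂σ := by
  rw [exponentMeasure, lintegral_map hF PosFun.measurable_scale]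
  exact lintegral_prod_symm' (μ := invSqMeasure) _ (hF.comp PosFun.measurable_scale)

theorem exponentMeasure_apply (σ : Measure (PosFun T)) [SFinite σ] {A : Set (PosFun T)}
    (hA : MeasurableSet A) :
    exponentMeasure σ A = ∫⁻ f, invSqMeasure {r | PosFun.scale r f ∈ A} ∂σ := by
  rw [← lintegral_indicator_one hA,
    lintegral_exponentMeasure σ (measurable_one.indicator hA)]
  refine lintegral_congr fun f => ?_
  have hm : MeasurableSet {r | PosFun.scale r f ∈ A} :=
    (PosFun.measurable_scale.comp (measurable_id.prodMk measurable_const)) hA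
  rw [← lintegral_indicator_one hm]
  rfl

/-- The conditional law of `f` given `f t = y` under the exponent measure: the law of
`(y / f t) f` when `f` has law `f(t) σ(df)`. -/
def rescaledKernel (σ : Measure (PosFun T)) (t : T) : Kernel ℝ (PosFun T) :=
  (Kernel.id ×ₖ Kernel.const ℝ (σ.withDensity (fun f => ENNReal.ofReal (f.1 t)))).map
    (fun p => PosFun.scale (p.1 / p.2.1 t) p.2)

theorem measurable_rescale (t : T) :
    Measurable (fun p : ℝ × PosFun T => PosFun.scale (p.1 / p.2.1 t) p.2) :=
  PosFun.measurable_scale.comp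
    ((measurable_fst.div ((PosFun.measurable_eval t).comp measurable_snd)).prodMk measurable_snd)

theorem lintegral_rescaledKernel (σ : Measure (PosFun T)) [SFinite σ] (t : T) (y : ℝ)
    {F : PosFun T → ℝ≥0∞} (hF : Measurable F) :
    ∫⁻ f, F f ∂(rescaledKernel σ t y) =
      ∫⁻ f, ENNReal.ofReal (f.1 t) * F (PosFun.scale (y / f.1 t) f) ∂σ := by
  have hm := PosFun.measurable_eval t
  have hs : Measurable (fun f : PosFun T => PosFun.scale (y / f.1 t) f) :=
    (measurable_rescale t).comp (measurable_const.prodMk measurable_id)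
  rw [rescaledKernel, Kernel.lintegral_map _ (measurable_rescale t) _ hF,
    Kernel.lintegral_id_prod (f := fun p : ℝ × PosFun T => F (PosFun.scale (p.1 / p.2.1 t) p.2))
      (hF.comp (measurable_rescale t)), Kernel.const_apply]
  exact lintegral_withDensity_eq_lintegral_mul _ (by fun_prop) (hF.comp hs)

theorem rescaledKernel_apply (σ : Measure (PosFun T)) [SFinite σ] (t : T) (y : ℝ)
    {A : Set (PosFun T)} (hA : MeasurableSet A) :
    rescaledKernel σ t y A =
      ∫⁻ f, A.indicator 1 (PosFun.scale (y / f.1 t) f) * ENNReal.ofReal (f.1 t) ∂σ := by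
  rw [← lintegral_indicator_one hA,
    lintegral_rescaledKernel σ t y (measurable_one.indicator hA)]
  simp_rw [mul_comm]

theorem IsSpectralMeasure.integrable_eval {σ : Measure (PosFun T)} (hσ : IsSpectralMeasure σ)
    (t : T) : Integrable (fun f : PosFun T => f.1 t) σ :=
  hσ.integrable_norm.mono (PosFun.measurable_eval t).aestronglyMeasurable
    (ae_of_all _ fun f => by simpa using f.1.norm_coe_le_norm t)

theorem IsSpectralMeasure.lintegral_eval {σ : Measure (PosFun T)} (hσ : IsSpectralMeasure σ)
    (t : T) : ∫⁻ f, ENNReal.ofReal (f.1 t) ∂σ = 1 := by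
  rw [← ofReal_integral_eq_lintegral_ofReal (hσ.integrable_eval t)
    (ae_of_all _ fun f => f.apply_nonneg t), hσ.mean_eq_one t, ENNReal.ofReal_one]

theorem isMarkovKernel_rescaledKernel {σ : Measure (PosFun T)} (hσ : IsSpectralMeasure σ) (t : T) :
    IsMarkovKernel (rescaledKernel σ t) := by
  have := hσ.prob
  refine ⟨fun y => ⟨?_⟩⟩
  rw [rescaledKernel_apply σ t y .univ]
  simpa using hσ.lintegral_eval t

/-- Fubini, then the substitution `y = r f(t)` for each fixed `f` with `f(t) > 0`. When `f(t) = 0`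
the right side has weight zero and the left side vanishes by `hF0`. -/
theorem lintegral_exponentMeasure_disintegrate {σ : Measure (PosFun T)} (hσ : IsSpectralMeasure σ)
    (t : T) {F : ℝ × PosFun T → ℝ≥0∞} (hF : Measurable F) (hF0 : ∀ f, F (0, f) = 0) :
    ∫⁻ f, F (f.1 t, f) ∂(exponentMeasure σ) =
      ∫⁻ y, ∫⁻ f, F (y, f) ∂(rescaledKernel σ t y) ∂invSqMeasure := by
  have := hσ.prob
  have hm := PosFun.measurable_eval t
  have hG : Measurable (fun p : ℝ × PosFun T => F (p.1, PosFun.scale (p.1 / p.2.1 t) p.2)) :=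
    hF.comp (measurable_fst.prodMk (measurable_rescale t))
  have h1 : ∀ y, ∫⁻ f, F (y, f) ∂(rescaledKernel σ t y) =
      ∫⁻ f, ENNReal.ofReal (f.1 t) * F (y, PosFun.scale (y / f.1 t) f) ∂σ := fun y =>
    lintegral_rescaledKernel σ t y (hF.comp (measurable_const.prodMk measurable_id))
  simp_rw [h1]
  rw [lintegral_lintegral_swap
    (((hm.comp measurable_snd).ennreal_ofReal).mul hG).aemeasurable,
    lintegral_exponentMeasure σ (F := fun f => F (f.1 t, f)) (hF.comp (hm.prodMk measurable_id))]
  refine lintegral_congr fun f => ?_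
  rcases (f.apply_nonneg t).eq_or_lt with h0 | hpos
  · rw [← h0]
    simp only [ENNReal.ofReal_zero, zero_mul, lintegral_zero]
    rw [← lintegral_zero (μ := invSqMeasure)]
    refine lintegral_congr_ae (ae_pos_invSqMeasure.mono fun r hr => ?_)
    simp [PosFun.scale_apply hr, ← h0, hF0]
  · have hGf : Measurable (fun y => F (y, PosFun.scale (y / f.1 t) f)) :=
      hG.comp (measurable_id.prodMk measurable_const)
    rw [lintegral_const_mul _ hGf, ← lintegral_invSqMeasure_comp_mul hpos hGf]
    refine lintegral_congr_ae (ae_pos_invSqMeasure.mono fun r hr => ?_)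
    simp [PosFun.scale_apply hr, hpos.ne']

theorem marginal_exponentMeasure {σ : Measure (PosFun T)} (hσ : IsSpectralMeasure σ) (t : T) :
    marginal (exponentMeasure σ) t = invSqMeasure := by
  have := isMarkovKernel_rescaledKernel hσ t
  have hm := PosFun.measurable_eval t
  ext B hB
  have hB' : MeasurableSet (B ∩ Set.Ioi 0) := hB.inter measurableSet_Ioi
  have h := lintegral_exponentMeasure_disintegrate hσ t
    (F := fun p => (B ∩ Set.Ioi 0).indicator 1 p.1)
    ((measurable_one.indicator hB').comp measurable_fst) (fun f => by simp)
  simp only [lintegral_const, measure_univ, mul_one] at h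
  rw [lintegral_indicator_one hB'] at h
  rw [marginal, Measure.restrict_apply hB, Measure.map_apply hm hB',
    ← lintegral_indicator_one (hm hB')]
  refine Eq.trans h (measure_congr ?_)
  filter_upwards [ae_pos_invSqMeasure] with x hx
  exact propext (and_iff_left hx)

theorem isConditionalMeasure_rescaledKernel {σ : Measure (PosFun T)} (hσ : IsSpectralMeasure σ)
    (t : T) : IsConditionalMeasure (rescaledKernel σ t) (exponentMeasure σ) t where
  prob := isMarkovKernel_rescaledKernel hσ t
  disintegrate F hF hF0 := by
    rw [marginal_exponentMeasure hσ]
    exact lintegral_exponentMeasure_disintegrate hσ t hF hF0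

theorem exponentMeasure_le_eval {σ : Measure (PosFun T)} (hσ : IsSpectralMeasure σ) (t : T) {x : ℝ}
    (hx : 0 < x) : exponentMeasure σ {f | x ≤ f.1 t} = ENNReal.ofReal x⁻¹ := by
  have h := congrArg (fun m => m (Set.Ici x)) (marginal_exponentMeasure hσ t)
  beta_reduce at h
  rw [invSqMeasure_Ici hx, marginal, Measure.restrict_apply measurableSet_Ici,
    Set.inter_eq_left.2 (Set.Ici_subset_Ioi.2 hx),
    Measure.map_apply (PosFun.measurable_eval t) measurableSet_Ici] at h
  exact h

/-- The mass is `∫ ‖f‖ dσ / x`, so this is where integrability of the norm enters. -/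
theorem exponentMeasure_norm_ne_top {σ : Measure (PosFun T)} (hσ : IsSpectralMeasure σ) {x : ℝ}
    (hx : 0 < x) : exponentMeasure σ {f | x ≤ ‖f.1‖} ≠ ∞ := by
  have := hσ.prob
  have hm : Measurable (fun f : PosFun T => ‖f.1‖) :=
    (show Continuous (fun f : PosFun T => ‖f.1‖) by fun_prop).measurable
  rw [exponentMeasure_apply σ (measurableSet_le measurable_const hm)]
  have h : ∀ f : PosFun T, invSqMeasure {r | PosFun.scale r f ∈ {f : PosFun T | x ≤ ‖f.1‖}} =
      ENNReal.ofReal (‖f.1‖ / x) := by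
    intro f
    rw [← invSqMeasure_one_le_mul (c := ENNReal.ofReal (‖f.1‖ / x)) ENNReal.ofReal_ne_top]
    refine measure_congr ?_
    filter_upwards [ae_pos_invSqMeasure] with r hr
    have : ‖(PosFun.scale r f).1‖ = r * ‖f.1‖ := by
      simp [PosFun.scale, hr, norm_smul, abs_of_pos hr]
    refine propext ?_
    change x ≤ ‖(PosFun.scale r f).1‖ ↔ 1 ≤ ENNReal.ofReal r * ENNReal.ofReal (‖f.1‖ / x)
    rw [this, ← ENNReal.ofReal_mul hr.le, ENNReal.one_le_ofReal, ← mul_div_assoc, one_le_div hx]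
  simp_rw [h]
  exact ((hσ.integrable_norm.div_const x).lintegral_lt_top).ne

end Exponent

/-! ### Void probabilities of Poisson random measures -/

section Poisson

variable {Ω E : Type*} [MeasurableSpace Ω] [MeasurableSpace E] {Φ : Ω → Measure E} {μ : Measure E}
  {P : Measure Ω}

theorem IsPoissonRandomMeasure.measurable_apply (h : IsPoissonRandomMeasure Φ μ P) {A : Set E}
    (hA : MeasurableSet A) : Measurable (fun ω => Φ ω A) :=
  (Measure.measurable_coe hA).comp h.measurable

theorem IsPoissonRandomMeasure.measure_eq_natCast (h : IsPoissonRandomMeasure Φ μ P) {A : Set E}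
    (hA : MeasurableSet A) (hμ : μ A ≠ ∞) (n : ℕ) :
    P {ω | Φ ω A = n} = poissonMeasure (μ A).toNNReal {n} := by
  have h1 := congrArg (fun m => m {(n : ℝ≥0∞)}) (h.poisson A hA hμ)
  beta_reduce at h1
  rw [Measure.map_apply (h.measurable_apply hA) (measurableSet_singleton _),
    Measure.map_apply (by fun_prop) (measurableSet_singleton _)] at h1
  refine Eq.trans h1 (congrArg _ ?_)
  ext m
  simp

theorem IsPoissonRandomMeasure.measure_eq_zero (h : IsPoissonRandomMeasure Φ μ P) {A : Set E}
    (hA : MeasurableSet A) : P {ω | Φ ω A = 0} = expNeg (μ A) := by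
  by_cases hμ : μ A = ∞
  · rw [hμ, expNeg_top]
    refine measure_mono_null ?_ (h.infinite A hA hμ)
    intro ω (h0 : Φ ω A = 0) (h1 : Φ ω A = ∞)
    simp [h0] at h1
  · have h1 := h.measure_eq_natCast hA hμ 0
    rw [poissonMeasure_singleton] at h1
    simpa [expNeg_of_ne_top hμ, ENNReal.toReal] using h1

theorem IsPoissonRandomMeasure.measure_eq_one (h : IsPoissonRandomMeasure Φ μ P) {A : Set E}
    (hA : MeasurableSet A) (hμ : μ A ≠ ∞) : P {ω | Φ ω A = 1} = expNeg (μ A) * μ A := by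
  have h1 := h.measure_eq_natCast hA hμ 1
  rw [poissonMeasure_singleton] at h1
  rw [expNeg_of_ne_top hμ]
  conv_rhs => rw [← ENNReal.ofReal_toReal hμ, ENNReal.toReal_ofReal ENNReal.toReal_nonneg]
  rw [← ENNReal.ofReal_mul (Real.exp_nonneg _)]
  simpa [ENNReal.toReal] using h1

/-- Independence on `S` and `V \ S` gives `e^{-μ(S)} μ(S) e^{-μ(V \ S)}`. Only `μ S` need be finite,
since `expNeg ∞ = 0` handles infinite `μ V`. -/
theorem IsPoissonRandomMeasure.measure_eq_one_and_diff_eq_zero (h : IsPoissonRandomMeasure Φ μ P)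
    {S V : Set E} (hS : MeasurableSet S) (hV : MeasurableSet V) (hSV : S ⊆ V) (hμ : μ S ≠ ∞) :
    P {ω | Φ ω S = 1 ∧ Φ ω (V \ S) = 0} = expNeg (μ V) * μ S := by
  have hind : IndepFun (fun ω => Φ ω S) (fun ω => Φ ω (V \ S)) P := by
    have hi := h.indep 2 ![S, V \ S] (by
        intro i; fin_cases i
        · exact hS
        · exact hV.diff hS) (by
        intro i j hij
        fin_cases i <;> fin_cases j
        · exact absurd rfl hij
        · exact Set.disjoint_sdiff_right
        · exact Set.disjoint_sdiff_left
        · exact absurd rfl hij)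
    exact hi.indepFun (i := 0) (j := 1) (by decide)
  have h1 := hind.measure_inter_preimage_eq_mul {1} {0} (measurableSet_singleton _)
    (measurableSet_singleton _)
  refine Eq.trans h1 ?_
  change P {ω | Φ ω S = 1} * P {ω | Φ ω (V \ S) = 0} = _
  rw [h.measure_eq_one hS hμ, h.measure_eq_zero (hV.diff hS), mul_right_comm, ← expNeg_add,
    measure_add_sdiff hS.nullMeasurableSet, Set.union_eq_self_of_subset_left hSV]

end Poisson

/-! ### Point measures and their extremal part -/

section PointMeasure

variable {T : Type*} [MetricSpace T]

theorem PosFun.measurableSet_le_eval (t : T) (a : ℝ) : MeasurableSet {f : PosFun T | a ≤ f.1 t} :=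
  measurableSet_le measurable_const (PosFun.measurable_eval t)

variable {M : Measure (PosFun T)} {t : T}

theorem apply_singleton_of_restrict {V : Set (PosFun T)} (g : PosFun T) (hg : g ∈ V) :
    M.restrict V {g} = M {g} := by
  rw [Measure.restrict_apply (measurableSet_singleton g),
    Set.inter_eq_left.2 (Set.singleton_subset_iff.2 hg)]

theorem le_eval_of_restrict_eq_dirac {a : ℝ} {g : PosFun T}
    (h : M.restrict {f | a ≤ f.1 t} = Measure.dirac g) : a ≤ g.1 t := by
  by_contra hlt
  have h1 : M.restrict {f | a ≤ f.1 t} {f | a ≤ f.1 t}ᶜ = 0 := by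
    rw [Measure.restrict_apply (PosFun.measurableSet_le_eval t a).compl]
    simp
  rw [h, Measure.dirac_apply' _ (PosFun.measurableSet_le_eval t a).compl,
    Set.indicator_of_mem (by exact hlt)] at h1
  exact one_ne_zero h1

theorem atom_of_restrict_eq_dirac {a : ℝ} {g : PosFun T}
    (h : M.restrict {f | a ≤ f.1 t} = Measure.dirac g) : M {g} = 1 := by
  rw [← apply_singleton_of_restrict (V := {f : PosFun T | a ≤ f.1 t}) g
    (le_eval_of_restrict_eq_dirac h), h]
  simp

theorem eval_le_of_restrict_eq_dirac {a : ℝ} {g : PosFun T}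
    (h : M.restrict {f | a ≤ f.1 t} = Measure.dirac g) {f : PosFun T} (hf : M {f} ≠ 0) :
    f.1 t ≤ g.1 t := by
  by_cases hfa : a ≤ f.1 t
  · rw [← apply_singleton_of_restrict (V := {f : PosFun T | a ≤ f.1 t}) f hfa, h] at hf
    rw [Measure.dirac_apply' _ (measurableSet_singleton f)] at hf
    have : g = f := Set.mem_singleton_iff.1 (Set.mem_of_indicator_ne_zero hf)
    rw [this]
  · exact (not_le.1 hfa).le.trans (le_eval_of_restrict_eq_dirac h)

theorem pointMax_of_restrict_eq_dirac {a : ℝ} {g : PosFun T}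
    (h : M.restrict {f | a ≤ f.1 t} = Measure.dirac g) : pointMax M t = g.1 t := by
  have hg : M {g} ≠ 0 := by rw [atom_of_restrict_eq_dirac h]; exact one_ne_zero
  have hne : Nonempty {f : PosFun T // M {f} ≠ 0} := ⟨⟨g, hg⟩⟩
  refine le_antisymm (ciSup_le fun f => eval_le_of_restrict_eq_dirac h f.2) ?_
  exact le_ciSup (f := fun f : {f : PosFun T // M {f} ≠ 0} => f.1.1 t)
    ⟨g.1 t, by rintro _ ⟨f, rfl⟩; exact eval_le_of_restrict_eq_dirac h f.2⟩ ⟨g, hg⟩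

/-- If `g` is the only point at or above level `a`, the maximum at `t` is `g t`, and the extremal
part is a further restriction of the Dirac mass to `{f | g t ≤ f t}`, which contains `g`. -/
theorem extremalPart_of_restrict_eq_dirac {a : ℝ} {g : PosFun T}
    (h : M.restrict {f | a ≤ f.1 t} = Measure.dirac g) :
    extremalPart {t} M = Measure.dirac g := by
  classical
  have hs : {f : PosFun T | ¬ ∀ s ∈ ({t} : Set T), f.1 s < pointMax M s} =
      {f | g.1 t ≤ f.1 t} := by
    ext f
    simp [pointMax_of_restrict_eq_dirac h]
  have hsub : {f : PosFun T | g.1 t ≤ f.1 t} ⊆ {f | a ≤ f.1 t} := fun f hf =>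
    (le_eval_of_restrict_eq_dirac h).trans hf
  rw [extremalPart, hs, ← Set.inter_eq_left.2 hsub,
    ← Measure.restrict_restrict (PosFun.measurableSet_le_eval t _), h,
    restrict_dirac' (PosFun.measurableSet_le_eval t _), if_pos]
  exact le_refl (g.1 t)

variable [CompactSpace T]

theorem IsPointMeasure.exists_restrict_eq_dirac (hM : IsPointMeasure M) {S V : Set (PosFun T)}
    (hS : MeasurableSet S) (hV : MeasurableSet V) (hSV : S ⊆ V) (h1 : M S = 1)
    (h0 : M (V \ S) = 0) : ∃ g ∈ S, M.restrict V = Measure.dirac g := by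
  classical
  obtain ⟨ι, f, rfl, -⟩ := hM
  rw [Measure.sum_apply _ hS] at h1
  rw [Measure.sum_apply _ (hV.diff hS), ENNReal.tsum_eq_zero] at h0
  simp_rw [Measure.dirac_apply' _ hS] at h1
  have hVS : ∀ i, f i ∈ V → f i ∈ S := by
    intro i hi
    by_contra hiS
    have := h0 i
    rw [Measure.dirac_apply' _ (hV.diff hS), Set.indicator_of_mem (by exact ⟨hi, hiS⟩)] at this
    exact one_ne_zero this
  obtain ⟨i, hi⟩ : ∃ i, f i ∈ S := by
    by_contra! hno
    simp [hno] at h1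
  -- A second index in `S` would give mass at least `2`, even if both indices carry the same
  -- function.
  have huniq : ∀ j, j ≠ i → f j ∉ S := by
    intro j hj hjS
    have := ENNReal.sum_le_tsum (f := fun i => S.indicator (1 : PosFun T → ℝ≥0∞) (f i)) {j, i}
    rw [h1, Finset.sum_pair hj, Set.indicator_of_mem hi, Set.indicator_of_mem hjS] at this
    norm_num at this
  refine ⟨f i, hi, ?_⟩
  rw [Measure.restrict_sum _ hV]
  ext A hA
  rw [Measure.sum_apply _ hA, tsum_eq_single i, restrict_dirac' hV, if_pos (hSV hi)]
  intro j hj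
  rw [restrict_dirac' hV, if_neg (fun h => huniq j hj (hVS j h))]
  rfl

theorem IsPointMeasure.bddAbove_atoms (hM : IsPointMeasure M) (s : T) :
    BddAbove (Set.range fun f : {f : PosFun T // M {f} ≠ 0} => f.1.1 s) := by
  obtain ⟨ι, f, hMf, hfin⟩ := hM
  -- Only finitely many points have norm above `1`, so the atoms are bounded in norm by the largest
  -- of these norms or by `1`.
  obtain ⟨C, hC⟩ := ((hfin 1 one_pos).image (fun i => ‖(f i).1‖)).bddAbove
  refine ⟨max C 1, ?_⟩
  rintro _ ⟨⟨g, hg⟩, rfl⟩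
  rw [hMf, Measure.sum_apply _ (measurableSet_singleton g), Ne, ENNReal.tsum_eq_zero] at hg
  push Not at hg
  obtain ⟨i, hi⟩ := hg
  rw [Measure.dirac_apply' _ (measurableSet_singleton g)] at hi
  have hig : f i = g := Set.mem_singleton_iff.1 (Set.mem_of_indicator_ne_zero hi)
  refine ((le_abs_self _).trans (g.1.norm_coe_le_norm s)).trans ?_
  rcases le_or_gt ‖g.1‖ 1 with h | h
  · exact h.trans (le_max_right _ _)
  · exact (hC ⟨i, by simpa [hig] using h, by simp [hig]⟩).trans (le_max_left _ _)

theorem IsPointMeasure.le_pointMax (hM : IsPointMeasure M) {f : PosFun T} (hf : M {f} ≠ 0) (s : T) :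
    f.1 s ≤ pointMax M s :=
  le_ciSup (f := fun f : {f : PosFun T // M {f} ≠ 0} => f.1.1 s) (hM.bddAbove_atoms s) ⟨f, hf⟩

/-- A point measure charges a measurable set if and only if it has an atom in it. -/
theorem IsPointMeasure.apply_eq_zero_iff (hM : IsPointMeasure M) {A : Set (PosFun T)}
    (hA : MeasurableSet A) : M A = 0 ↔ ∀ f, M {f} ≠ 0 → f ∉ A := by
  constructor
  · intro h f hf hfA
    exact hf (measure_mono_null (Set.singleton_subset_iff.2 hfA) h)
  · intro h
    obtain ⟨ι, f, rfl, -⟩ := hM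
    rw [Measure.sum_apply _ hA, ENNReal.tsum_eq_zero]
    intro i
    rw [Measure.dirac_apply' _ hA, Set.indicator_of_notMem]
    refine h (f i) ?_
    rw [Measure.sum_apply _ (measurableSet_singleton _), Ne, ENNReal.tsum_eq_zero]
    push Not
    exact ⟨i, by simp⟩

end PointMeasure

/-! ### The law of the extremal function -/

section VoidProb

variable {T : Type*} [MetricSpace T]

/-- The probability that a Poisson random measure with intensity `μ` has no point in `D` and no
point `f` with `a ≤ f t`; it is set to `0` for `a ≤ 0`. -/
def voidProb (μ : Measure (PosFun T)) (t : T) (D : Set (PosFun T)) (a : ℝ) : ℝ≥0∞ :=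
  if 0 < a then expNeg (μ (D ∪ {f | a ≤ f.1 t})) else 0

variable {μ : Measure (PosFun T)} {t : T} {D : Set (PosFun T)}

theorem voidProb_of_pos {a : ℝ} (ha : 0 < a) :
    voidProb μ t D a = expNeg (μ (D ∪ {f | a ≤ f.1 t})) := if_pos ha

theorem voidProb_of_nonpos {a : ℝ} (ha : a ≤ 0) : voidProb μ t D a = 0 := if_neg ha.not_gt

theorem voidProb_mono : Monotone (voidProb μ t D) := by
  intro a b hab
  rcases le_or_gt a 0 with ha | ha
  · rw [voidProb_of_nonpos ha]; exact zero_le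
  · rw [voidProb_of_pos ha, voidProb_of_pos (ha.trans_le hab)]
    exact expNeg_antitone (measure_mono (Set.union_subset_union_right _ fun f hf => hab.trans hf))

theorem measurable_voidProb : Measurable (voidProb μ t D) := voidProb_mono.measurable

theorem voidProb_le_empty (a : ℝ) : voidProb μ t D a ≤ voidProb μ t ∅ a := by
  rcases le_or_gt a 0 with ha | ha
  · rw [voidProb_of_nonpos ha]; exact zero_le
  · rw [voidProb_of_pos ha, voidProb_of_pos ha]
    exact expNeg_antitone (measure_mono (Set.union_subset_union_left _ (Set.empty_subset _)))

/-- Splits the forbidden region at level `a`: the part below gives the exponential of the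
conditional distribution function, the part above gives a factor that conditioning removes. -/
theorem voidProb_eq_mul {a : ℝ} (ha : 0 < a) :
    voidProb μ t D a =
      expNeg (μ (D ∩ {f | f.1 t < a})) * voidProb μ t ∅ a := by
  have hm := PosFun.measurableSet_le_eval t a
  rw [voidProb_of_pos ha, voidProb_of_pos ha, ← expNeg_add, Set.empty_union,
    ← measure_union _ hm]
  · congr 2
    ext f
    simp only [Set.mem_union, Set.mem_inter_iff, Set.mem_ofPred_eq]
    have := lt_or_ge (f.1 t) a
    tauto
  · exact Set.disjoint_left.2 fun f hf (hf' : a ≤ f.1 t) => not_lt.2 hf' hf.2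

variable [CompactSpace T] {σ : Measure (PosFun T)}

theorem voidProb_empty_eq (hσ : IsSpectralMeasure σ) {a : ℝ} (ha : 0 < a) :
    voidProb (exponentMeasure σ) t ∅ a = expNeg (ENNReal.ofReal a⁻¹) := by
  rw [voidProb_of_pos ha, Set.empty_union, exponentMeasure_le_eval hσ t ha]

theorem lintegral_voidProb_empty (hσ : IsSpectralMeasure σ) :
    ∫⁻ f, voidProb (exponentMeasure σ) t ∅ (f.1 t) ∂(exponentMeasure σ) = 1 := by
  have := isMarkovKernel_rescaledKernel hσ t
  -- The convention `voidProb = 0` at level `0` supplies the vanishing on `{0} × ℂ₀` that the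
  -- disintegration requires.
  have h := lintegral_exponentMeasure_disintegrate hσ t
    (F := fun p => voidProb (exponentMeasure σ) t ∅ p.1)
    (measurable_voidProb.comp measurable_fst) (fun f => voidProb_of_nonpos le_rfl)
  simp only [lintegral_const, measure_univ, mul_one] at h
  rw [h, ← lintegral_expNeg_inv]
  exact lintegral_congr_ae (ae_pos_invSqMeasure.mono fun r hr => voidProb_empty_eq hσ hr)

/-- Left continuity of `voidProb`. -/
theorem tendsto_voidProb (hσ : IsSpectralMeasure σ) {ι : Type*} {l : Filter ι} {u : ι → ℝ} {x : ℝ}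
    (hx : 0 < x) (hu : Filter.Tendsto u l (nhds x)) (hle : ∀ i, u i ≤ x) :
    Filter.Tendsto (fun i => voidProb (exponentMeasure σ) t D (u i)) l
      (nhds (voidProb (exponentMeasure σ) t D x)) := by
  set μ := exponentMeasure σ
  -- Lowering the level from `x` to `u i` adds mass at most `1 / u i - 1 / x`. The multiplicative
  -- bound avoids continuity from above for `μ`, which could fail because `μ D` may be infinite.
  have hlow : ∀ᶠ i in l, voidProb μ t D x *
      expNeg (ENNReal.ofReal (u i)⁻¹ - ENNReal.ofReal x⁻¹) ≤ voidProb μ t D (u i) := by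
    filter_upwards [hu.eventually (lt_mem_nhds hx)] with i hi
    rw [voidProb_of_pos hx, voidProb_of_pos hi, ← expNeg_add]
    refine expNeg_antitone ?_
    have hsub : {f : PosFun T | x ≤ f.1 t} ⊆ {f | u i ≤ f.1 t} := fun f hf => (hle i).trans hf
    rw [← exponentMeasure_le_eval hσ t hx, ← exponentMeasure_le_eval hσ t hi,
      ← measure_sdiff hsub (PosFun.measurableSet_le_eval t x).nullMeasurableSet
        (by rw [exponentMeasure_le_eval hσ t hx]; exact ENNReal.ofReal_ne_top)]
    refine (measure_mono ?_).trans (measure_union_le _ _)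
    intro f hf
    simp only [Set.mem_union, Set.mem_sdiff, Set.mem_ofPred_eq] at hf ⊢
    tauto
  refine tendsto_of_tendsto_of_tendsto_of_le_of_le' ?_ tendsto_const_nhds hlow
    (.of_forall fun i => voidProb_mono (hle i))
  have h1 : Filter.Tendsto (fun i => ENNReal.ofReal (u i)⁻¹ - ENNReal.ofReal x⁻¹) l (nhds 0) := by
    have := ENNReal.Tendsto.sub ((ENNReal.continuous_ofReal.tendsto _).comp (hu.inv₀ hx.ne'))
      (tendsto_const_nhds (x := ENNReal.ofReal x⁻¹)) (Or.inl ENNReal.ofReal_ne_top)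
    simpa using this
  have h2 := ENNReal.Tendsto.const_mul (a := voidProb μ t D x)
    (tendsto_expNeg ENNReal.zero_ne_top h1) (Or.inl (by simp [expNeg_zero]))
  rwa [expNeg_zero, mul_one] at h2

/-- Rounding down to the grid of mesh `1 / (n + 1)`. -/
def gridFloor (n : ℕ) (x : ℝ) : ℝ := (⌊((n : ℝ) + 1) * x⌋₊ : ℝ) / ((n : ℝ) + 1)

theorem measurable_gridFloor (n : ℕ) : Measurable (gridFloor n) := by
  unfold gridFloor
  exact ((measurable_from_nat (f := fun k : ℕ => (k : ℝ))).comp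
    (Nat.measurable_floor.comp (by fun_prop))).div_const _

theorem gridFloor_le (n : ℕ) {x : ℝ} (hx : 0 ≤ x) : gridFloor n x ≤ x := by
  have hn : (0 : ℝ) < n + 1 := by positivity
  rw [gridFloor, div_le_iff₀ hn, mul_comm x]
  exact Nat.floor_le (by positivity)

theorem tendsto_gridFloor {x : ℝ} (hx : 0 ≤ x) :
    Filter.Tendsto (fun n => gridFloor n x) Filter.atTop (nhds x) := by
  have h := (tendsto_nat_floor_mul_div_atTop hx).comp
    (Filter.tendsto_atTop_add_const_right _ (1 : ℝ) tendsto_natCast_atTop_atTop)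
  refine h.congr fun n => ?_
  simp [gridFloor, mul_comm]

/-- Dominated convergence: rounding down and enlarging `D` only decrease `voidProb`, so the
integrand is bounded by `voidProb` with `D = ∅` at the exact level, whose integral is `1`. -/
theorem tendsto_lintegral_voidProb_gridFloor (hσ : IsSpectralMeasure σ) (A : Set (PosFun T)) :
    Filter.Tendsto (fun n => ∫⁻ f in A, voidProb (exponentMeasure σ) t D (gridFloor n (f.1 t))
      ∂(exponentMeasure σ)) Filter.atTop
      (nhds (∫⁻ f in A, voidProb (exponentMeasure σ) t D (f.1 t) ∂(exponentMeasure σ))) := by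
  refine tendsto_lintegral_of_dominated_convergence
    (fun f => voidProb (exponentMeasure σ) t ∅ (f.1 t)) (fun n => ?_)
    (fun n => ae_of_all _ fun f => ?_) ?_ (ae_of_all _ fun f => ?_)
  · exact measurable_voidProb.comp ((measurable_gridFloor n).comp (PosFun.measurable_eval t))
  · exact (voidProb_mono (gridFloor_le n (f.apply_nonneg t))).trans (voidProb_le_empty _)
  · refine ((setLIntegral_le_lintegral _ _).trans_lt ?_).ne
    rw [lintegral_voidProb_empty hσ]
    exact ENNReal.one_lt_top
  · rcases (f.apply_nonneg t).eq_or_lt with h0 | hpos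
    · rw [← h0]
      simp [gridFloor]
    · exact tendsto_voidProb hσ hpos (tendsto_gridFloor hpos.le)
        (fun n => gridFloor_le n hpos.le)

end VoidProb

/-! ### Discretised records, and existence and joint law of the extremal function -/

section Record

variable {T : Type*} [MetricSpace T]

/-- The functions of `A \ D` with value at `t` in `[a, b)`. -/
def slice (t : T) (A D : Set (PosFun T)) (a b : ℝ) : Set (PosFun T) :=
  (A \ D) ∩ {f | a ≤ f.1 t ∧ f.1 t < b}

theorem measurableSet_slice (t : T) {A D : Set (PosFun T)} (hA : MeasurableSet A)
    (hD : MeasurableSet D) (a b : ℝ) : MeasurableSet (slice t A D a b) :=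
  (hA.diff hD).inter ((PosFun.measurableSet_le_eval t a).inter
    (measurableSet_lt (PosFun.measurable_eval t) measurable_const))

theorem slice_subset (t : T) (A D : Set (PosFun T)) (a b : ℝ) :
    slice t A D a b ⊆ D ∪ {f | a ≤ f.1 t} := fun _ hf => Or.inr hf.2.1

/-- The measure `M` has exactly one point in `D ∪ {f | a ≤ f t}`, and this point belongs to
`A \ D` and has its value at `t` in `[a, b)`. -/
def IsRecord (t : T) (A D : Set (PosFun T)) (a b : ℝ) (M : Measure (PosFun T)) : Prop :=
  M (slice t A D a b) = 1 ∧ M ((D ∪ {f | a ≤ f.1 t}) \ slice t A D a b) = 0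

variable {t : T} {A D : Set (PosFun T)} {a b : ℝ} {M : Measure (PosFun T)}

/-- A record in a higher slice would be a point of `{f | a ≤ f t}` outside the lower slice, where
the lower record allows none. Hence the events indexed by the grid are disjoint. -/
theorem not_isRecord_of_le (h : IsRecord t A D a b M) {a' b' : ℝ} (hab : a ≤ b) (hb : b ≤ a') :
    ¬ IsRecord t A D a' b' M := by
  intro h'
  have : M (slice t A D a' b') = 0 := by
    have hsub : slice t A D a' b' ⊆ (D ∪ {f | a ≤ f.1 t}) \ slice t A D a b := fun f hf =>
      ⟨Or.inr ((hab.trans hb).trans hf.2.1), fun hf' => not_lt.2 (hb.trans hf.2.1) hf'.2.2⟩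
    exact measure_mono_null hsub h.2
  rw [h'.1] at this
  exact one_ne_zero this

theorem isRecord_of_restrict_eq_dirac (hA : MeasurableSet A) (hD : MeasurableSet D) {g : PosFun T}
    (hg : g ∈ slice t A D a b) (hMD : M D = 0)
    (h : M.restrict {f | a ≤ f.1 t} = Measure.dirac g) : IsRecord t A D a b M := by
  have hS := measurableSet_slice t hA hD a b
  have hsub : slice t A D a b ⊆ {f | a ≤ f.1 t} := fun f hf => hf.2.1
  constructor
  · rw [← Set.inter_eq_left.2 hsub, ← Measure.restrict_apply hS, h, Measure.dirac_apply' _ hS,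
      Set.indicator_of_mem hg]
    rfl
  · rw [Set.union_sdiff_distrib]
    refine measure_union_null (measure_mono_null Set.sdiff_subset hMD) ?_
    rw [Set.sdiff_eq, Set.inter_comm, ← Measure.restrict_apply hS.compl, h,
      Measure.dirac_apply' _ hS.compl, Set.indicator_of_notMem (by simpa using hg)]

theorem measurableSet_isRecord {Ω : Type*} [MeasurableSpace Ω] {P : Measure Ω}
    {Φ : Ω → Measure (PosFun T)} {μ : Measure (PosFun T)}
    (h : IsPoissonRandomMeasure Φ μ P)
    (hA : MeasurableSet A) (hD : MeasurableSet D) (a b : ℝ) :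
    MeasurableSet {ω | IsRecord t A D a b (Φ ω)} := by
  have hS := measurableSet_slice t hA hD a b
  exact (h.measurable_apply hS (measurableSet_singleton 1)).inter
    (h.measurable_apply ((hD.union (PosFun.measurableSet_le_eval t a)).diff hS)
      (measurableSet_singleton 0))

/-- There is a single point with the largest value at `t`, up to mesh `1 / (n + 1)`; it belongs to
`A \ D`, and there is no point in `D`. -/
def HasRecord (t : T) (A D : Set (PosFun T)) (n : ℕ) (M : Measure (PosFun T)) : Prop :=
  ∃ k : ℕ, IsRecord t A D (((k : ℝ) + 1) / (n + 1)) (((k : ℝ) + 2) / (n + 1)) M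

theorem measurableSet_hasRecord {Ω : Type*} [MeasurableSpace Ω] {P : Measure Ω}
    {Φ : Ω → Measure (PosFun T)} {μ : Measure (PosFun T)}
    (h : IsPoissonRandomMeasure Φ μ P)
    (hA : MeasurableSet A) (hD : MeasurableSet D) (n : ℕ) :
    MeasurableSet {ω | HasRecord t A D n (Φ ω)} := by
  have : {ω | HasRecord t A D n (Φ ω)} = ⋃ k : ℕ,
      {ω | IsRecord t A D (((k : ℝ) + 1) / (n + 1)) (((k : ℝ) + 2) / (n + 1)) (Φ ω)} := by
    ext ω; simp [HasRecord]
  rw [this]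
  exact .iUnion fun k => measurableSet_isRecord h hA hD _ _

variable [CompactSpace T]

theorem IsRecord.exists_restrict_eq_dirac (hM : IsPointMeasure M) (hA : MeasurableSet A)
    (hD : MeasurableSet D) (h : IsRecord t A D a b M) :
    ∃ g ∈ slice t A D a b, M D = 0 ∧ M.restrict {f | a ≤ f.1 t} = Measure.dirac g := by
  classical
  have hVm := PosFun.measurableSet_le_eval t a
  obtain ⟨g, hg, hgM⟩ := hM.exists_restrict_eq_dirac (measurableSet_slice t hA hD a b)
    (hD.union hVm) (slice_subset t A D a b) h.1 h.2
  refine ⟨g, hg, ?_, ?_⟩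
  · rw [← Set.inter_eq_left.2 (Set.subset_union_left : D ⊆ D ∪ {f | a ≤ f.1 t}),
      ← Measure.restrict_apply hD, hgM, Measure.dirac_apply' _ hD,
      Set.indicator_of_notMem hg.1.2]
  · rw [← Set.inter_eq_left.2
      (Set.subset_union_right : {f : PosFun T | a ≤ f.1 t} ⊆ D ∪ {f | a ≤ f.1 t}),
      ← Measure.restrict_restrict hVm, hgM, restrict_dirac' hVm, if_pos]
    exact hg.2.1

theorem HasRecord.exists_extremal (hM : IsPointMeasure M) (hA : MeasurableSet A)
    (hD : MeasurableSet D) {n : ℕ} (h : HasRecord t A D n M) :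
    ∃ g ∈ A \ D, M D = 0 ∧ M {g} ≠ 0 ∧ pointMax M t = g.1 t ∧
      extremalPart {t} M = Measure.dirac g := by
  obtain ⟨k, hk⟩ := h
  obtain ⟨g, hg, hMD, hgM⟩ := hk.exists_restrict_eq_dirac hM hA hD
  refine ⟨g, hg.1, hMD, ?_, pointMax_of_restrict_eq_dirac hgM,
    extremalPart_of_restrict_eq_dirac hgM⟩
  rw [atom_of_restrict_eq_dirac hgM]
  exact one_ne_zero

/-- An unrestricted record is already the extremal function, so knowing that this function is in `A
\ D` and that `D` is empty of points makes it a record for `A`, `D` in the same grid cell. -/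
theorem HasRecord.refine (hM : IsPointMeasure M) (hA : MeasurableSet A)
    (hD : MeasurableSet D) {n : ℕ} (h : HasRecord t Set.univ ∅ n M) {g : PosFun T}
    (hg : extremalPart {t} M = Measure.dirac g) (hgA : g ∈ A \ D) (hMD : M D = 0) :
    HasRecord t A D n M := by
  obtain ⟨k, hk⟩ := h
  obtain ⟨g', hg', -, hgM⟩ := hk.exists_restrict_eq_dirac hM .univ .empty
  have : g' = g := by
    rw [extremalPart_of_restrict_eq_dirac hgM] at hg
    exact dirac_eq_dirac_iff.1 hg
  subst this
  exact ⟨k, isRecord_of_restrict_eq_dirac hA hD ⟨hgA, hg'.2⟩ hMD hgM⟩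

variable {Ω : Type*} [MeasurableSpace Ω] {P : Measure Ω} {σ : Measure (PosFun T)}
  {Φ : Ω → Measure (PosFun T)}

theorem measure_isRecord (hσ : IsSpectralMeasure σ)
    (h : IsPoissonRandomMeasure Φ (exponentMeasure σ) P) (hA : MeasurableSet A)
    (hD : MeasurableSet D) (ha : 0 < a) :
    P {ω | IsRecord t A D a b (Φ ω)} =
      voidProb (exponentMeasure σ) t D a * exponentMeasure σ (slice t A D a b) := by
  rw [voidProb_of_pos ha]
  refine h.measure_eq_one_and_diff_eq_zero (measurableSet_slice t hA hD a b)
    (hD.union (PosFun.measurableSet_le_eval t a)) (slice_subset t A D a b) ?_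
  have hsub : slice t A D a b ⊆ {f | a ≤ f.1 t} := fun f hf => hf.2.1
  refine ne_top_of_le_ne_top ?_ (measure_mono hsub)
  rw [exponentMeasure_le_eval hσ t ha]
  exact ENNReal.ofReal_ne_top

theorem mem_grid_iff (n k : ℕ) {x : ℝ} (hx : 0 ≤ x) :
    ((k : ℝ) / (n + 1) ≤ x ∧ x < ((k : ℝ) + 1) / (n + 1)) ↔ ⌊((n : ℝ) + 1) * x⌋₊ = k := by
  have hn : (0 : ℝ) < n + 1 := by positivity
  rw [Nat.floor_eq_iff (by positivity), div_le_iff₀ hn, lt_div_iff₀ hn, mul_comm x]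

theorem measure_hasRecord (hσ : IsSpectralMeasure σ)
    (h : IsPoissonRandomMeasure Φ (exponentMeasure σ) P) (hA : MeasurableSet A)
    (hD : MeasurableSet D) (n : ℕ) :
    P {ω | HasRecord t A D n (Φ ω)} =
      ∫⁻ f in A \ D, voidProb (exponentMeasure σ) t D (gridFloor n (f.1 t))
        ∂(exponentMeasure σ) := by
  set μ := exponentMeasure σ
  have hn : (0 : ℝ) < n + 1 := by positivity
  have hU : {ω | HasRecord t A D n (Φ ω)} = ⋃ k : ℕ,
      {ω | IsRecord t A D (((k : ℝ) + 1) / (n + 1)) (((k : ℝ) + 2) / (n + 1)) (Φ ω)} := by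
    ext ω; simp [HasRecord]
  have hdisj : Pairwise (Function.onFun Disjoint fun k : ℕ =>
      {ω | IsRecord t A D (((k : ℝ) + 1) / (n + 1)) (((k : ℝ) + 2) / (n + 1)) (Φ ω)}) := by
    refine (pairwise_disjoint_on _).2 fun k l hkl => Set.disjoint_left.2 fun ω hk hl => ?_
    have hkl' : (k : ℝ) + 1 ≤ l := by exact_mod_cast hkl
    refine not_isRecord_of_le hk ?_ ?_ hl
    · exact div_le_div_of_nonneg_right (by linarith) hn.le
    · exact div_le_div_of_nonneg_right (by linarith) hn.le
  have hS : ∀ k : ℕ, MeasurableSet (slice t A D ((k : ℝ) / (n + 1)) (((k : ℝ) + 1) / (n + 1))) :=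
    fun k => measurableSet_slice t hA hD _ _
  have hSU : A \ D = ⋃ k : ℕ, slice t A D ((k : ℝ) / (n + 1)) (((k : ℝ) + 1) / (n + 1)) := by
    ext f
    simp only [slice, Set.mem_iUnion, Set.mem_inter_iff, Set.mem_ofPred_eq,
      mem_grid_iff n _ (f.apply_nonneg t)]
    exact ⟨fun hf => ⟨_, hf, rfl⟩, fun ⟨k, hf, _⟩ => hf⟩
  have hSd : Pairwise (Function.onFun Disjoint fun k : ℕ =>
      slice t A D ((k : ℝ) / (n + 1)) (((k : ℝ) + 1) / (n + 1))) := by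
    intro k l hkl
    refine Set.disjoint_left.2 fun f hk hl => hkl ?_
    rw [← (mem_grid_iff n k (f.apply_nonneg t)).1 hk.2,
      ← (mem_grid_iff n l (f.apply_nonneg t)).1 hl.2]
  have hint : ∀ k : ℕ, ∫⁻ f in slice t A D ((k : ℝ) / (n + 1)) (((k : ℝ) + 1) / (n + 1)),
      voidProb μ t D (gridFloor n (f.1 t)) ∂μ = voidProb μ t D ((k : ℝ) / (n + 1)) *
        μ (slice t A D ((k : ℝ) / (n + 1)) (((k : ℝ) + 1) / (n + 1))) := by
    intro k
    rw [← setLIntegral_const]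
    refine setLIntegral_congr_fun (hS k) fun f hf => ?_
    simp only [gridFloor, (mem_grid_iff n k (f.apply_nonneg t)).1 hf.2]
  rw [hU, measure_iUnion hdisj fun k => measurableSet_isRecord h hA hD _ _, hSU,
    lintegral_iUnion hS hSd, tsum_congr hint]
  -- The lowest cell contributes nothing because `voidProb` vanishes at level `0`; this matches the
  -- shift by `1` in `HasRecord`.
  conv_rhs => rw [tsum_eq_zero_add' ENNReal.summable, Nat.cast_zero, zero_div,
    voidProb_of_nonpos le_rfl, zero_mul, zero_add]
  refine tsum_congr fun k => ?_
  rw [measure_isRecord hσ h hA hD (by positivity)]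
  push_cast
  rw [add_assoc (k : ℝ) 1 1, one_add_one_eq_two]

theorem tendsto_measure_hasRecord (hσ : IsSpectralMeasure σ)
    (h : IsPoissonRandomMeasure Φ (exponentMeasure σ) P) (hA : MeasurableSet A)
    (hD : MeasurableSet D) :
    Filter.Tendsto (fun n => P {ω | HasRecord t A D n (Φ ω)}) Filter.atTop
      (nhds (∫⁻ f in A \ D, voidProb (exponentMeasure σ) t D (f.1 t) ∂(exponentMeasure σ))) := by
  simp_rw [measure_hasRecord hσ h hA hD]
  exact tendsto_lintegral_voidProb_gridFloor hσ _

theorem tendsto_measure_hasRecord_univ (hσ : IsSpectralMeasure σ)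
    (h : IsPoissonRandomMeasure Φ (exponentMeasure σ) P) :
    Filter.Tendsto (fun n => P {ω | HasRecord t Set.univ ∅ n (Φ ω)}) Filter.atTop (nhds 1) := by
  have := tendsto_measure_hasRecord (t := t) hσ h .univ .empty
  rwa [Set.sdiff_empty, Measure.restrict_univ, lintegral_voidProb_empty hσ] at this

variable [IsProbabilityMeasure P]

theorem ae_exists_hasRecord (hσ : IsSpectralMeasure σ)
    (h : IsPoissonRandomMeasure Φ (exponentMeasure σ) P) (t : T) :
    ∀ᵐ ω ∂P, ∃ n, HasRecord t Set.univ ∅ n (Φ ω) := by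
  have hm : MeasurableSet (⋃ n : ℕ, {ω | HasRecord t Set.univ ∅ n (Φ ω)}) :=
    .iUnion fun n => measurableSet_hasRecord h .univ .empty n
  have h1 : P (⋃ n : ℕ, {ω | HasRecord t Set.univ ∅ n (Φ ω)}) = 1 :=
    le_antisymm prob_le_one (le_of_tendsto' (tendsto_measure_hasRecord_univ (t := t) hσ h)
      fun n => measure_mono (Set.subset_iUnion_of_subset n subset_rfl))
  filter_upwards [(mem_ae_iff_prob_eq_one hm).2 h1] with ω hω
  exact Set.mem_iUnion.1 hω

/-- The joint law of the extremal function and of the points in `D`. -/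
theorem measure_extremal_mem_and_eq_zero (hσ : IsSpectralMeasure σ)
    (h : IsPoissonRandomMeasure Φ (exponentMeasure σ) P) (hM : ∀ᵐ ω ∂P, IsPointMeasure (Φ ω))
    {φ : Ω → PosFun T} (hφ : ∀ᵐ ω ∂P, extremalPart {t} (Φ ω) = Measure.dirac (φ ω))
    (hA : MeasurableSet A) (hD : MeasurableSet D) :
    P {ω | φ ω ∈ A \ D ∧ Φ ω D = 0} =
      ∫⁻ f in A \ D, voidProb (exponentMeasure σ) t D (f.1 t) ∂(exponentMeasure σ) := by
  have hlim := tendsto_measure_hasRecord (t := t) hσ h hA hD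
  have hlim1 : Filter.Tendsto (fun n => P {ω | HasRecord t Set.univ ∅ n (Φ ω)}ᶜ) Filter.atTop
      (nhds 0) := by
    have h1 := ENNReal.Tendsto.sub (tendsto_const_nhds (x := (1 : ℝ≥0∞)))
      (tendsto_measure_hasRecord_univ (t := t) hσ h) (Or.inl ENNReal.one_ne_top)
    rw [tsub_self] at h1
    exact h1.congr fun n => (prob_compl_eq_one_sub (measurableSet_hasRecord h .univ .empty n)).symm
  refine le_antisymm ?_ (le_of_tendsto' hlim fun n => measure_mono_ae ?_)
  -- Upper bound: the event lies in `HasRecord t A D n`, up to the failure of the grid to isolate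
  -- the maximiser, whose probability tends to `0`.
  · have h2 := hlim.add hlim1
    rw [add_zero] at h2
    refine ge_of_tendsto' h2 fun n => (measure_mono_ae ?_).trans (measure_union_le _ _)
    filter_upwards [hM, hφ] with ω hω hφω hX
    by_cases hr : HasRecord t Set.univ ∅ n (Φ ω)
    · exact Or.inl (hr.refine hω hA hD hφω hX.1 hX.2)
    · exact Or.inr hr
  · filter_upwards [hM, hφ] with ω hω hφω hX
    obtain ⟨g, hg, hMD, -, -, hext⟩ := HasRecord.exists_extremal hω hA hD hX
    have : g = φ ω := dirac_eq_dirac_iff.1 (hext.symm.trans hφω)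
    exact ⟨by rwa [← this], hMD⟩

theorem ae_pointMax_eq (hσ : IsSpectralMeasure σ)
    (h : IsPoissonRandomMeasure Φ (exponentMeasure σ) P) (hM : ∀ᵐ ω ∂P, IsPointMeasure (Φ ω))
    {φ : Ω → PosFun T} (hφ : ∀ᵐ ω ∂P, extremalPart {t} (Φ ω) = Measure.dirac (φ ω)) :
    ∀ᵐ ω ∂P, Φ ω {φ ω} ≠ 0 ∧ pointMax (Φ ω) t = (φ ω).1 t := by
  filter_upwards [hM, hφ, ae_exists_hasRecord hσ h t] with ω hω hφω ⟨n, hn⟩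
  obtain ⟨g, -, -, hg, hmax, hext⟩ := HasRecord.exists_extremal hω .univ .empty hn
  have : g = φ ω := dirac_eq_dirac_iff.1 (hext.symm.trans hφω)
  exact this ▸ ⟨hg, hmax⟩

theorem exists_isExtremalFunction [Nonempty T] (hσ : IsSpectralMeasure σ)
    (h : IsPoissonRandomMeasure Φ (exponentMeasure σ) P) (hM : ∀ᵐ ω ∂P, IsPointMeasure (Φ ω))
    (t : T) : ∃ φ : Ω → PosFun T, IsExtremalFunction φ Φ t P := by
  classical
  have hex : ∀ᵐ ω ∂P, ∃ g, extremalPart {t} (Φ ω) = Measure.dirac g := by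
    filter_upwards [hM, ae_exists_hasRecord hσ h t] with ω hω ⟨n, hn⟩
    obtain ⟨g, -, -, -, -, hext⟩ := HasRecord.exists_extremal hω .univ .empty hn
    exact ⟨g, hext⟩
  let φ : Ω → PosFun T := fun ω =>
    if hω : ∃ g, extremalPart {t} (Φ ω) = Measure.dirac g then hω.choose else Classical.arbitrary _
  have hφ : ∀ᵐ ω ∂P, extremalPart {t} (Φ ω) = Measure.dirac (φ ω) := by
    filter_upwards [hex] with ω hω
    simp only [φ, dif_pos hω]
    exact hω.choose_spec
  refine ⟨φ, NullMeasurable.aemeasurable fun A hA => ?_, hφ⟩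
  -- `φ` comes from choice, but up to a null set `φ ∈ A` means that some grid has a record in `A`,
  -- which is a measurable event.
  have hU : MeasurableSet (⋃ n : ℕ, {ω | HasRecord t A ∅ n (Φ ω)}) :=
    .iUnion fun n => measurableSet_hasRecord h hA .empty n
  refine hU.nullMeasurableSet.congr ?_
  filter_upwards [hM, hφ, ae_exists_hasRecord hσ h t] with ω hω hφω ⟨n, hn⟩
  refine propext ⟨fun hω' => ?_, fun hω' => ?_⟩
  · obtain ⟨m, hm⟩ := Set.mem_iUnion.1 hω'
    obtain ⟨g, hg, -, -, -, hext⟩ := HasRecord.exists_extremal hω hA .empty hm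
    have : g = φ ω := dirac_eq_dirac_iff.1 (hext.symm.trans hφω)
    exact Set.mem_preimage.2 (by rw [← this]; exact hg.1)
  · exact Set.mem_iUnion.2 ⟨n, hn.refine hω hA .empty hφω ⟨hω', fun h => h⟩ measure_empty⟩

end Record

/-! ### Upper bounds on finitely many open sets -/

section BoundedOn

variable {T : Type*} [MetricSpace T]

/-- The functions bounded by `w i` on `U i`, for all `i`. -/
def boundedOn {l : ℕ} (U : Fin l → Set T) (w : Fin l → ℝ) : Set C(T, ℝ) :=
  {g | ∀ i, ∀ s ∈ U i, g s ≤ w i}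

theorem isClosed_boundedOn {l : ℕ} (U : Fin l → Set T) (w : Fin l → ℝ) :
    IsClosed (boundedOn U w) := by
  have : boundedOn U w = ⋂ i, ⋂ s ∈ U i, {g : C(T, ℝ) | g s ≤ w i} := by
    ext g; simp [boundedOn]
  rw [this]
  exact isClosed_iInter fun i => isClosed_biInter fun s _ =>
    isClosed_le (by fun_prop) continuous_const

/-- The functions in `ℂ₀` outside of `A`. -/
def outside (A : Set C(T, ℝ)) : Set (PosFun T) := {f | f.1 ∉ A}

theorem measurableSet_outside {A : Set C(T, ℝ)} (hA : MeasurableSet A) :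
    MeasurableSet (outside A) := measurable_subtype_coe hA.compl

theorem measurableSet_exists_le {l : ℕ} (s : Fin l → T) (z : Fin l → ℝ) :
    MeasurableSet {f : PosFun T | ∃ i, z i ≤ f.1 (s i)} := by
  have : {f : PosFun T | ∃ i, z i ≤ f.1 (s i)} = ⋃ i, {f | z i ≤ f.1 (s i)} := by ext; simp
  rw [this]
  exact .iUnion fun i => PosFun.measurableSet_le_eval (s i) (z i)

variable [CompactSpace T] {σ : Measure (PosFun T)}

theorem exponentMeasure_outside_ne_top (hσ : IsSpectralMeasure σ) {l : ℕ} (U : Fin l → Set T)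
    {w : Fin l → ℝ} (hw : ∀ i, 0 < w i) :
    exponentMeasure σ (outside (boundedOn U w)) ≠ ∞ := by
  have hsub : outside (boundedOn U w) ⊆ ⋃ i, {f | w i ≤ ‖f.1‖} := by
    intro f hf
    simp only [outside, boundedOn, Set.mem_ofPred_eq, not_forall, not_le] at hf
    obtain ⟨i, s, -, hs⟩ := hf
    exact Set.mem_iUnion.2 ⟨i, hs.le.trans ((le_abs_self _).trans (f.1.norm_coe_le_norm s))⟩
  refine ne_top_of_le_ne_top ?_ ((measure_mono hsub).trans (measure_iUnion_fintype_le _ _))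
  exact ENNReal.sum_ne_top.2 fun i _ => exponentMeasure_norm_ne_top hσ (hw i)

/-- Rational bounds keep the family of boxes countable; positive ones keep the mass outside a box
finite. -/
theorem exists_seq_rat_pos_mono {z : ℝ} (hz : 0 < z) :
    ∃ u : ℕ → ℚ, Monotone u ∧ (∀ n, 0 < (u n : ℝ) ∧ (u n : ℝ) < z) ∧
      Filter.Tendsto (fun n => (u n : ℝ)) Filter.atTop (nhds z) := by
  obtain ⟨u, hmono, hlt, hlim⟩ := Real.exists_seq_rat_strictMono_tendsto z
  obtain ⟨N, hN⟩ := (hlim.eventually (lt_mem_nhds hz)).exists_forall_of_atTop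
  exact ⟨fun n => u (n + N), fun a b hab => hmono.monotone (by omega),
    fun n => ⟨hN _ (by omega), hlt _⟩, hlim.comp (Filter.tendsto_add_atTop_nat N)⟩

/-- An identity between a finite measure of boxes and a Poisson expression extends from boxes
defined by basic open sets and rational bounds to finite dimensional distribution functions. -/
theorem measure_lt_eq_of_boundedOn {μ : Measure (PosFun T)} {ν : Measure C(T, ℝ)}
    {ρ : Measure (PosFun T)} [IsFiniteMeasure ρ] (H : Set (PosFun T)) (hH : MeasurableSet H)
    (hμ : ∀ {l : ℕ} (U : Fin l → Set T) (w : Fin l → ℝ), (∀ i, 0 < w i) →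
      μ (outside (boundedOn U w)) ≠ ∞)
    (h : ∀ (l : ℕ) (U : Fin l → TopologicalSpace.countableBasis T) (w : Fin l → ℚ),
      (∀ i, 0 < (w i : ℝ)) → ν (boundedOn (fun i => (U i : Set T)) (fun i => (w i : ℝ))) =
        expNeg (μ (outside (boundedOn (fun i => (U i : Set T)) (fun i => (w i : ℝ))) ∩ H)) *
          ρ (outside (boundedOn (fun i => (U i : Set T)) (fun i => (w i : ℝ))))ᶜ)
    {l : ℕ} (s : Fin l → T) (z : Fin l → ℝ) (hz : ∀ i, 0 < z i) :
    ν {g | ∀ i, g (s i) < z i} =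
      expNeg (μ ({f | ∃ i, z i ≤ f.1 (s i)} ∩ H)) * ρ {f | ∀ i, f.1 (s i) < z i} := by
  -- Levels increase to `z i` while neighbourhoods shrink to `s i`, so the boxes increase. By
  -- continuity of `g` their union is exactly the set of `g` with `g (s i) < z i` for all `i`.
  choose w hwm hwz hwlim using fun i => exists_seq_rat_pos_mono (hz i)
  choose U hU hUb using fun i =>
    ((TopologicalSpace.isBasis_countableBasis T).nhds_hasBasis (a := s i)).exists_antitone_subbasis
  set A : ℕ → Set C(T, ℝ) := fun n => boundedOn (fun i => U i n) (fun i => (w i n : ℝ)) with hA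
  have hAm : ∀ n, MeasurableSet (outside (A n)) := fun n =>
    measurableSet_outside (isClosed_boundedOn _ _).measurableSet
  have hAmono : Monotone A := fun m n hmn g hg i x hx =>
    (hg i x ((hUb i).2 hmn hx)).trans (Rat.cast_le.2 (hwm i hmn))
  have hAU : ∀ g : C(T, ℝ), (∃ n, g ∈ A n) ↔ ∀ i, g (s i) < z i := by
    intro g
    constructor
    · rintro ⟨n, hn⟩ i
      exact (hn i (s i) (hU i n).2).trans_lt (hwz i n).2
    · intro hg
      have : ∀ i, ∀ᶠ n in Filter.atTop, ∀ x ∈ U i n, g x ≤ w i n := by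
        intro i
        obtain ⟨m, hm1, hm2⟩ := exists_between (hg i)
        have hnb : {x | g x < m} ∈ nhds (s i) :=
          (isOpen_lt g.continuous continuous_const).mem_nhds hm1
        filter_upwards [(hUb i).eventually_subset hnb,
          (hwlim i).eventually (lt_mem_nhds hm2)] with n hn1 hn2 x hx
        exact (le_of_lt (hn1 hx)).trans hn2.le
      obtain ⟨n, hn⟩ := (Filter.eventually_all.2 this).exists
      exact ⟨n, hn⟩
  have h1 : Filter.Tendsto (fun n => ν (A n)) Filter.atTop (nhds (ν {g | ∀ i, g (s i) < z i})) := by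
    have : {g : C(T, ℝ) | ∀ i, g (s i) < z i} = ⋃ n, A n := by
      ext g; rw [Set.mem_iUnion, hAU]; rfl
    rw [this]
    exact tendsto_measure_iUnion_atTop hAmono
  have h2 : Filter.Tendsto (fun n => ρ (outside (A n))ᶜ) Filter.atTop
      (nhds (ρ {f | ∀ i, f.1 (s i) < z i})) := by
    have : {f : PosFun T | ∀ i, f.1 (s i) < z i} = ⋃ n, (outside (A n))ᶜ := by
      ext f; simp only [Set.mem_iUnion, outside, Set.mem_compl_iff, Set.mem_ofPred_eq, not_not, hAU]
    rw [this]
    refine tendsto_measure_iUnion_atTop fun m n hmn => Set.compl_subset_compl.2 ?_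
    exact fun f hf hfm => hf (hAmono hmn hfm)
  have h3 : Filter.Tendsto (fun n => μ (outside (A n) ∩ H)) Filter.atTop
      (nhds (μ ({f | ∃ i, z i ≤ f.1 (s i)} ∩ H))) := by
    have : {f : PosFun T | ∃ i, z i ≤ f.1 (s i)} ∩ H = ⋂ n, outside (A n) ∩ H := by
      rw [← Set.iInter_inter]
      congr 1
      ext f
      have := not_congr (hAU f.1)
      push Not at this
      rw [Set.mem_iInter]
      exact this.symm
    rw [this]
    refine tendsto_measure_iInter_atTop (fun n => ((hAm n).inter hH).nullMeasurableSet)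
      (fun m n hmn => Set.inter_subset_inter_left _ fun f hf hfm => hf (hAmono hmn hfm))
      ⟨0, ne_top_of_le_ne_top (hμ _ _ fun i => (hwz i 0).1) (measure_mono Set.inter_subset_left)⟩
  have hfin : μ ({f | ∃ i, z i ≤ f.1 (s i)} ∩ H) ≠ ∞ := by
    refine ne_top_of_le_ne_top (hμ (fun i => U i 0) (fun i => (w i 0 : ℝ)) fun i => (hwz i 0).1)
      (measure_mono ?_)
    rintro f ⟨⟨i, hi⟩, -⟩ hfA
    exact absurd ((hAU f.1).1 ⟨0, hfA⟩ i) (not_lt.2 hi)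
  have h4 := ENNReal.Tendsto.mul (tendsto_expNeg hfin h3) (Or.inr (measure_ne_top ρ _)) h2
    (Or.inr (expNeg_ne_top _))
  refine tendsto_nhds_unique h1 (h4.congr fun n => ?_)
  exact (h l (fun i => ⟨U i n, (hU i n).1⟩) (fun i => w i n) fun i => (hwz i n).1).symm

/-! ### Explicit expressions -/

/-- Positivity of `b` matters only for `l = 0`, where the supremum is `0`. -/
theorem iSup_lt_iff_of_pos {l : ℕ} {a : Fin l → ℝ≥0∞} {b : ℝ≥0∞} (hb : 0 < b) :
    ⨆ i, a i < b ↔ ∀ i, a i < b := by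
  rw [← Finset.sup_univ_eq_iSup, Finset.sup_lt_iff (by exact hb)]
  simp

theorem ofReal_mul_div_lt_one_iff {r x z : ℝ} (hr : 0 < r) (hz : 0 < z) :
    ENNReal.ofReal r * (ENNReal.ofReal x / ENNReal.ofReal z) < 1 ↔ r * x < z := by
  rw [← ENNReal.ofReal_div_of_pos hz, ← ENNReal.ofReal_mul hr.le, ENNReal.ofReal_lt_one,
    ← mul_div_assoc, div_lt_one hz]

theorem iSup_div_ne_top {l : ℕ} (x : Fin l → ℝ) {z : Fin l → ℝ} (hz : ∀ i, 0 < z i) :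
    ⨆ i, ENNReal.ofReal (x i) / ENNReal.ofReal (z i) ≠ ∞ := by
  have hfin : ∀ i, ENNReal.ofReal (x i) / ENNReal.ofReal (z i) < ∞ := fun i => by
    rw [← ENNReal.ofReal_div_of_pos (hz i)]
    exact ENNReal.ofReal_lt_top
  exact ((iSup_lt_iff_of_pos ENNReal.zero_lt_top).2 hfin).ne

/-- For fixed `f`, the admissible radii `r` satisfy `1 ≤ r ⋁ f(s_i)/z_i` and `r f(t)/y < 1`; their
mass under `r⁻² dr` is the truncated difference of the two coefficients. -/
theorem exponentMeasure_exists_le_inter_lt (hσ : IsSpectralMeasure σ) (t : T) {y : ℝ} (hy : 0 < y)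
    {l : ℕ} (s : Fin l → T) {z : Fin l → ℝ} (hz : ∀ i, 0 < z i) :
    exponentMeasure σ ({f | ∃ i, z i ≤ f.1 (s i)} ∩ {f | f.1 t < y}) =
      ∫⁻ f, ((⨆ i, ENNReal.ofReal (f.1 (s i)) / ENNReal.ofReal (z i)) -
        ENNReal.ofReal (f.1 t) / ENNReal.ofReal y) ∂σ := by
  have := hσ.prob
  rw [exponentMeasure_apply σ ((measurableSet_exists_le s z).inter
    (measurableSet_lt (PosFun.measurable_eval t) measurable_const))]
  refine lintegral_congr fun f => ?_
  have hd : ENNReal.ofReal (f.1 t) / ENNReal.ofReal y ≠ ∞ := by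
    rw [← ENNReal.ofReal_div_of_pos hy]
    exact ENNReal.ofReal_ne_top
  rw [← invSqMeasure_one_le_mul_and_mul_lt (iSup_div_ne_top (fun i => f.1 (s i)) hz) hd]
  refine measure_congr ?_
  filter_upwards [ae_pos_invSqMeasure] with r hr
  refine propext ?_
  change ((∃ i, z i ≤ (PosFun.scale r f).1 (s i)) ∧ (PosFun.scale r f).1 t < y) ↔ (1 ≤ _ ∧ _ < 1)
  rw [ofReal_mul_div_lt_one_iff hr hy, PosFun.scale_apply hr, ENNReal.mul_iSup, ← not_lt,
    iSup_lt_iff_of_pos one_pos]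
  simp only [ofReal_mul_div_lt_one_iff hr (hz _), PosFun.scale_apply hr, not_forall, not_lt]

theorem rescaledKernel_forall_lt (hσ : IsSpectralMeasure σ) (t : T) {y : ℝ} (hy : 0 < y)
    {l : ℕ} (s : Fin l → T) {z : Fin l → ℝ} (hz : ∀ i, 0 < z i) :
    rescaledKernel σ t y {f | ∀ i, f.1 (s i) < z i} =
      ∫⁻ f, {f : PosFun T | (⨆ i, ENNReal.ofReal (f.1 (s i)) / ENNReal.ofReal (z i)) <
        ENNReal.ofReal (f.1 t) / ENNReal.ofReal y}.indicator
          (fun f => ENNReal.ofReal (f.1 t)) f ∂σ := by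
  have := hσ.prob
  have hm : MeasurableSet {f : PosFun T | ∀ i, f.1 (s i) < z i} := by
    convert! (measurableSet_exists_le s z).compl using 1
    ext f
    simp
  rw [rescaledKernel_apply σ t y hm]
  refine lintegral_congr fun f => ?_
  rcases (f.apply_nonneg t).eq_or_lt with h0 | hpos
  · rw [← h0, ENNReal.ofReal_zero, mul_zero, Set.indicator_of_notMem]
    simp [← h0]
  have hd : 0 < ENNReal.ofReal (f.1 t) / ENNReal.ofReal y := by
    rw [← ENNReal.ofReal_div_of_pos hy]
    exact ENNReal.ofReal_pos.2 (by positivity)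
  have hiff : PosFun.scale (y / f.1 t) f ∈ {f : PosFun T | ∀ i, f.1 (s i) < z i} ↔
      f ∈ {f : PosFun T | (⨆ i, ENNReal.ofReal (f.1 (s i)) / ENNReal.ofReal (z i)) <
        ENNReal.ofReal (f.1 t) / ENNReal.ofReal y} := by
    rw [Set.mem_ofPred_eq, Set.mem_ofPred_eq, iSup_lt_iff_of_pos hd]
    refine forall_congr' fun i => ?_
    rw [PosFun.scale_apply (by positivity), ← ENNReal.ofReal_div_of_pos hy,
      ← ENNReal.ofReal_div_of_pos (hz i), ENNReal.ofReal_lt_ofReal_iff (by positivity),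
      div_lt_div_iff₀ (hz i) hy, div_mul_eq_mul_div, div_lt_iff₀ hpos, mul_comm y, mul_comm (z i)]
  by_cases hf : PosFun.scale (y / f.1 t) f ∈ {f : PosFun T | ∀ i, f.1 (s i) < z i}
  · rw [Set.indicator_of_mem hf, Set.indicator_of_mem (hiff.1 hf), Pi.one_apply, one_mul]
  · rw [Set.indicator_of_notMem hf, Set.indicator_of_notMem (fun h => hf (hiff.2 h)), zero_mul]

/-- The integrand is infinite wherever `f (s i) > 0`, hence dominates `∞ * f (s i)`, whose integral
is infinite because `f (s i)` has mean `1`. -/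
theorem lintegral_iSup_div_sub_eq_top (hσ : IsSpectralMeasure σ) (t : T) {y : ℝ} (hy : 0 < y)
    {l : ℕ} (s : Fin l → T) {z : Fin l → ℝ} {i : Fin l} (hi : z i = 0) :
    ∫⁻ f, ((⨆ i, ENNReal.ofReal (f.1 (s i)) / ENNReal.ofReal (z i)) -
      ENNReal.ofReal (f.1 t) / ENNReal.ofReal y) ∂σ = ∞ := by
  have hmi := PosFun.measurable_eval (s i)
  have h : ∫⁻ f, ∞ * ENNReal.ofReal (f.1 (s i)) ∂σ = ∞ := by
    rw [lintegral_const_mul _ (by fun_prop), hσ.lintegral_eval, mul_one]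
  rw [eq_top_iff, ← h]
  refine lintegral_mono fun f => ?_
  rcases eq_or_ne (ENNReal.ofReal (f.1 (s i))) 0 with h0 | h0
  · simp [h0]
  · have hc : ⨆ i, ENNReal.ofReal (f.1 (s i)) / ENNReal.ofReal (z i) = ∞ := by
      refine eq_top_iff.2 (le_trans ?_ (le_iSup _ i))
      rw [hi, ENNReal.ofReal_zero, ENNReal.div_zero h0]
    have hd : ENNReal.ofReal (f.1 t) / ENNReal.ofReal y ≠ ∞ := by
      rw [← ENNReal.ofReal_div_of_pos hy]
      exact ENNReal.ofReal_ne_top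
    rw [hc, ENNReal.top_sub hd]
    exact le_top

end BoundedOn

/-! ### Conditioning on the value at a point -/

section Conditioning

variable {T Ω : Type*} [MetricSpace T] [CompactSpace T] [MeasurableSpace Ω] {P : Measure Ω}
  {η : Ω → C(T, ℝ)} {σ : Measure (PosFun T)} {Φ : Ω → Measure (PosFun T)} {t : T}
  {φ : Ω → PosFun T} {κ : Kernel ℝ (PosFun T)}

theorem measurable_evalAt (hη : IsSimpleMaxStable η P) (t : T) : Measurable (fun ω => η ω t) :=
  (show Continuous (fun g : C(T, ℝ) => g t) by fun_prop).measurable.comp hη.measurable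

/-- Non-strict bounds pass to suprema, so a bound on `η` is a bound on every atom. Nonnegative `w`
is needed for the empty supremum, which equals `0`. -/
theorem mem_boundedOn_iff (hη : IsMaxStableFieldWith η σ Φ P) {l : ℕ} (U : Fin l → Set T)
    {w : Fin l → ℝ} (hw : ∀ i, 0 ≤ w i) :
    ∀ᵐ ω ∂P, η ω ∈ boundedOn U w ↔ Φ ω (outside (boundedOn U w)) = 0 := by
  filter_upwards [hη.pointMeasure, hη.eq_max] with ω hM hω
  rw [hM.apply_eq_zero_iff (measurableSet_outside (isClosed_boundedOn U w).measurableSet)]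
  constructor
  · intro h f hf hfA
    refine hfA fun i s hs => (hM.le_pointMax hf s).trans ?_
    rw [← hω s]
    exact h i s hs
  · intro h i s hs
    rw [hω s]
    refine Real.iSup_le (fun f => ?_) (hw i)
    have := h f.1 f.2
    rw [outside, Set.notMem_ofPred_iff, not_not] at this
    exact this i s hs

variable [IsProbabilityMeasure P]

theorem ae_extremal (hη : IsMaxStableFieldWith η σ Φ P)
    (hφ : ∀ᵐ ω ∂P, extremalPart {t} (Φ ω) = Measure.dirac (φ ω)) :
    ∀ᵐ ω ∂P, Φ ω {φ ω} ≠ 0 ∧ η ω t = (φ ω).1 t := by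
  filter_upwards [ae_pointMax_eq hη.spectral hη.poisson hη.pointMeasure hφ, hη.eq_max]
    with ω h1 h2
  exact ⟨h1.1, (h2 t).trans h1.2⟩

/-- Almost surely `η t = φ t` and `φ` is an atom, so `Φ D = 0` already forces `φ ∉ D`. The event is
then the one in `measure_extremal_mem_and_eq_zero`, and disintegrating along the value at `t` gives
the integral in `y`. -/
theorem measure_joint (hη : IsMaxStableFieldWith η σ Φ P)
    (hφ : ∀ᵐ ω ∂P, extremalPart {t} (Φ ω) = Measure.dirac (φ ω))
    (hκ : IsConditionalMeasure κ (exponentMeasure σ) t) {C : Set (ℝ × PosFun T)}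
    (hC : MeasurableSet C) {D : Set (PosFun T)} (hD : MeasurableSet D) :
    P {ω | (η ω t, φ ω) ∈ C ∧ Φ ω D = 0} =
      ∫⁻ y, voidProb (exponentMeasure σ) t D y * κ y {f | (y, f) ∈ C ∧ f ∉ D} ∂invSqMeasure := by
  have hm := PosFun.measurable_eval t
  have hA : MeasurableSet {f : PosFun T | (f.1 t, f) ∈ C} :=
    (show Measurable (fun f : PosFun T => (f.1 t, f)) from hm.prodMk measurable_id) hC
  have hCD : MeasurableSet (C ∩ {p | p.2 ∉ D}) := hC.inter (measurable_snd hD.compl)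
  have h1 : P {ω | (η ω t, φ ω) ∈ C ∧ Φ ω D = 0} =
      P {ω | φ ω ∈ {f : PosFun T | (f.1 t, f) ∈ C} \ D ∧ Φ ω D = 0} := by
    refine measure_congr ?_
    filter_upwards [ae_extremal hη hφ] with ω ⟨hat, hval⟩
    refine propext ?_
    change ((η ω t, φ ω) ∈ C ∧ Φ ω D = 0) ↔ ((((φ ω).1 t, φ ω) ∈ C ∧ φ ω ∉ D) ∧ Φ ω D = 0)
    rw [hval]
    refine ⟨fun h => ⟨⟨h.1, fun hmem => hat ?_⟩, h.2⟩, fun h => ⟨h.1.1, h.2⟩⟩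
    exact measure_mono_null (Set.singleton_subset_iff.2 hmem) h.2
  rw [h1, measure_extremal_mem_and_eq_zero hη.spectral hη.poisson hη.pointMeasure hφ hA hD,
    ← lintegral_indicator (hA.diff hD)]
  have h2 := hκ.disintegrate
    (fun p => voidProb (exponentMeasure σ) t D p.1 * (C ∩ {p | p.2 ∉ D}).indicator 1 p)
    ((measurable_voidProb.comp measurable_fst).mul (measurable_one.indicator hCD))
    (fun f => by rw [voidProb_of_nonpos le_rfl, zero_mul])
  rw [marginal_exponentMeasure hη.spectral] at h2
  refine Eq.trans (lintegral_congr fun f => ?_) (h2.trans (lintegral_congr fun y => ?_))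
  · by_cases hf : f ∈ {f : PosFun T | (f.1 t, f) ∈ C} \ D
    · rw [Set.indicator_of_mem hf, Set.indicator_of_mem (by exact hf), Pi.one_apply, mul_one]
    · rw [Set.indicator_of_notMem hf, Set.indicator_of_notMem (by exact hf), mul_zero]
  · have hmy : Measurable (fun f : PosFun T => (y, f)) := measurable_const.prodMk measurable_id
    have hS : MeasurableSet {f | (y, f) ∈ C ∧ f ∉ D} := hmy hCD
    rw [← lintegral_indicator_one hS, ← lintegral_const_mul _ (measurable_one.indicator hS)]
    refine lintegral_congr fun f => ?_
    by_cases hf : (y, f) ∈ C ∩ {p | p.2 ∉ D}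
    · rw [Set.indicator_of_mem hf, Set.indicator_of_mem (by exact hf)]
      rfl
    · rw [Set.indicator_of_notMem hf, Set.indicator_of_notMem (by exact hf)]

/-- The law of `η t` has density `e^{-1/y}` with respect to `y⁻² dy` on `(0, ∞)`. -/
theorem map_eval_eq [Nonempty T] (hη : IsMaxStableFieldWith η σ Φ P) (t : T) :
    P.map (fun ω => η ω t) =
      invSqMeasure.withDensity (voidProb (exponentMeasure σ) t ∅) := by
  obtain ⟨φ, hφ⟩ := exists_isExtremalFunction hη.spectral hη.poisson hη.pointMeasure t
  have := isMarkovKernel_rescaledKernel hη.spectral t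
  ext B hB
  have h := measure_joint hη hφ.extremalPart_eq
    (isConditionalMeasure_rescaledKernel hη.spectral t) (measurable_fst hB) .empty
  rw [Measure.map_apply (measurable_evalAt hη.simpleMaxStable t) hB, withDensity_apply _ hB,
    ← lintegral_indicator hB]
  refine Eq.trans ?_ (h.trans (lintegral_congr fun y => ?_))
  · congr 1
    ext ω
    simp
  · by_cases hy : y ∈ B <;> simp [hy]

theorem lintegral_map_eval [Nonempty T] (hη : IsMaxStableFieldWith η σ Φ P) (t : T)
    {G : ℝ → ℝ≥0∞} (hG : Measurable G) :
    ∫⁻ y, G y ∂(P.map (fun ω => η ω t)) =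
      ∫⁻ y, voidProb (exponentMeasure σ) t ∅ y * G y ∂invSqMeasure := by
  rw [map_eval_eq hη t, lintegral_withDensity_eq_lintegral_mul _ measurable_voidProb hG]
  rfl

theorem ae_pos_map_eval [Nonempty T] (hη : IsMaxStableFieldWith η σ Φ P) (t : T) :
    ∀ᵐ y ∂(P.map (fun ω => η ω t)), 0 < y := by
  rw [map_eval_eq hη t]
  exact (withDensity_absolutelyContinuous _ _).ae_le ae_pos_invSqMeasure

/-- The conditional law of the extremal function given the value of the field at `t`. -/
theorem condDistrib_extremal_ae_eq [Nonempty T] (hη : IsMaxStableFieldWith η σ Φ P)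
    (hφ : IsExtremalFunction φ Φ t P) (hκ : IsConditionalMeasure κ (exponentMeasure σ) t) :
    condDistrib φ (fun ω => η ω t) P =ᵐ[P.map (fun ω => η ω t)] κ := by
  have := hκ.prob
  have hηt := measurable_evalAt hη.simpleMaxStable t
  refine condDistrib_ae_eq_of_measure_eq_compProd _ hφ.aemeasurable ?_
  ext C hC
  rw [Measure.map_apply_of_aemeasurable (hηt.aemeasurable.prodMk hφ.aemeasurable) hC,
    Measure.compProd_apply hC,
    lintegral_map_eval hη t (Kernel.measurable_kernel_prodMk_left hC)]
  have h := measure_joint hη hφ.extremalPart_eq hκ hC .empty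
  simpa using! h

/-- Both sides are integrated over a Borel set of values of `η t`. The joint formula contains
`voidProb` for `D`, which factors through `voidProb` for `∅`, the density of `η t`. -/
theorem condDistrib_apply_ae_eq [Nonempty T] (hη : IsMaxStableFieldWith η σ Φ P) (t : T)
    {A : Set C(T, ℝ)} (hA : MeasurableSet A) {D : Set (PosFun T)} (hD : MeasurableSet D)
    (hAD : ∀ᵐ ω ∂P, η ω ∈ A ↔ Φ ω D = 0) :
    ∀ᵐ y ∂(P.map (fun ω => η ω t)), condDistrib η (fun ω => η ω t) P y A =
      expNeg (exponentMeasure σ (D ∩ {f | f.1 t < y})) * rescaledKernel σ t y Dᶜ := by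
  obtain ⟨φ, hφ⟩ := exists_isExtremalFunction hη.spectral hη.poisson hη.pointMeasure t
  have := isMarkovKernel_rescaledKernel hη.spectral t
  have hηt := measurable_evalAt hη.simpleMaxStable t
  have : IsProbabilityMeasure (P.map (fun ω => η ω t)) :=
    Measure.isProbabilityMeasure_map hηt.aemeasurable
  have hmono : Monotone fun y => exponentMeasure σ (D ∩ {f | f.1 t < y}) := fun a b hab =>
    measure_mono (Set.inter_subset_inter_right _ fun f (hf : f.1 t < a) => hf.trans_le hab)
  have hmG : Measurable fun y => expNeg (exponentMeasure σ (D ∩ {f | f.1 t < y})) *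
      rescaledKernel σ t y Dᶜ :=
    (measurable_expNeg.comp hmono.measurable).mul (Kernel.measurable_coe _ hD.compl)
  refine ae_eq_of_forall_setLIntegral_eq_of_sigmaFinite (Kernel.measurable_coe _ hA) hmG
    fun B hB _ => ?_
  rw [← Measure.compProd_apply_prod hB hA, compProd_map_condDistrib
    hη.simpleMaxStable.measurable.aemeasurable, Measure.map_apply
    (hηt.prodMk hη.simpleMaxStable.measurable) (hB.prod hA), ← lintegral_indicator hB,
    lintegral_map_eval hη t (hmG.indicator hB)]
  have h := measure_joint hη hφ.extremalPart_eq
    (isConditionalMeasure_rescaledKernel hη.spectral t) (measurable_fst hB) hD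
  refine Eq.trans (measure_congr ?_) (h.trans (lintegral_congr_ae ?_))
  · filter_upwards [hAD] with ω hω
    exact propext (and_congr_right fun _ => hω)
  · filter_upwards [ae_pos_invSqMeasure] with y hy
    by_cases hyB : y ∈ B
    · rw [Set.indicator_of_mem hyB, voidProb_eq_mul hy]
      have : {f : PosFun T | (y, f) ∈ Prod.fst ⁻¹' B ∧ f ∉ D} = Dᶜ := by
        ext f; simp [hyB]
      rw [this]
      ring
    · simp [hyB]

theorem condDistrib_nonneg_ae (hη : IsMaxStableFieldWith η σ Φ P) (t : T) :
    ∀ᵐ y ∂(P.map (fun ω => η ω t)), ∀ᵐ g ∂(condDistrib η (fun ω => η ω t) P y), 0 ≤ g := by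
  have hηt := measurable_evalAt hη.simpleMaxStable t
  have hcl : IsClosed {g : C(T, ℝ) | 0 ≤ g} := by
    have : {g : C(T, ℝ) | 0 ≤ g} = ⋂ s, {g | 0 ≤ g s} := by ext g; simp [ContinuousMap.le_def]
    rw [this]
    exact isClosed_iInter fun s => isClosed_le continuous_const (by fun_prop)
  refine Measure.ae_ae_of_ae_compProd (p := fun p : ℝ × C(T, ℝ) => 0 ≤ p.2) ?_
  rw [compProd_map_condDistrib hη.simpleMaxStable.measurable.aemeasurable,
    ae_map_iff (hηt.prodMk hη.simpleMaxStable.measurable).aemeasurable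
      (show MeasurableSet {p : ℝ × C(T, ℝ) | 0 ≤ p.2} from measurable_snd hcl.measurableSet)]
  filter_upwards [hη.eq_max] with ω hω s
  change 0 ≤ η ω s
  rw [hω s]
  exact Real.iSup_nonneg fun f => f.1.apply_nonneg s

/-- The conditional distribution functions of the field given its value at `t`. -/
theorem condDistrib_lt_ae_eq [Nonempty T] (hη : IsMaxStableFieldWith η σ Φ P) (t : T) :
    ∀ᵐ y ∂(P.map (fun ω => η ω t)),
      ∀ (l : ℕ) (s : Fin l → T) (z : Fin l → ℝ), (∀ i, 0 ≤ z i) →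
        condDistrib η (fun ω => η ω t) P y {g : C(T, ℝ) | ∀ i, g (s i) < z i} =
          expNeg (∫⁻ f, ((⨆ i, ENNReal.ofReal (f.1 (s i)) / ENNReal.ofReal (z i)) -
              ENNReal.ofReal (f.1 t) / ENNReal.ofReal y) ∂σ) *
          ∫⁻ f, {f : PosFun T | (⨆ i, ENNReal.ofReal (f.1 (s i)) / ENNReal.ofReal (z i)) <
              ENNReal.ofReal (f.1 t) / ENNReal.ofReal y}.indicator
                (fun f => ENNReal.ofReal (f.1 t)) f ∂σ := by
  have hσ := hη.spectral
  have := isMarkovKernel_rescaledKernel hσ t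
  have : Countable (TopologicalSpace.countableBasis T) :=
    (TopologicalSpace.countable_countableBasis T).to_subtype
  -- Basic open sets and rational levels form a countable family, so a single null set of `y` serves
  -- every box, and then every `s` and `z`.
  have hbox : ∀ᵐ y ∂(P.map (fun ω => η ω t)), ∀ (l : ℕ)
      (U : Fin l → TopologicalSpace.countableBasis T) (w : Fin l → ℚ), (∀ i, 0 < (w i : ℝ)) →
      condDistrib η (fun ω => η ω t) P y
          (boundedOn (fun i => (U i : Set T)) (fun i => (w i : ℝ))) =
        expNeg (exponentMeasure σ (outside (boundedOn (fun i => (U i : Set T))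
          (fun i => (w i : ℝ))) ∩ {f | f.1 t < y})) *
        rescaledKernel σ t y (outside (boundedOn (fun i => (U i : Set T))
          (fun i => (w i : ℝ))))ᶜ := by
    refine ae_all_iff.2 fun l => ae_all_iff.2 fun U => ae_all_iff.2 fun w => ?_
    by_cases hw : ∀ i, 0 < (w i : ℝ)
    · have hcl := isClosed_boundedOn (fun i => (U i : Set T)) (fun i => (w i : ℝ))
      filter_upwards [condDistrib_apply_ae_eq hη t hcl.measurableSet
        (measurableSet_outside hcl.measurableSet)
        (mem_boundedOn_iff hη _ fun i => (hw i).le)] with y hy _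
      exact hy
    · exact ae_of_all _ fun y h => absurd h hw
  filter_upwards [hbox, ae_pos_map_eval hη t, condDistrib_nonneg_ae hη t] with y hbox hy hnn l s z hz
  by_cases hz' : ∀ i, 0 < z i
  · rw [measure_lt_eq_of_boundedOn {f | f.1 t < y}
      (measurableSet_lt (PosFun.measurable_eval t) measurable_const)
      (fun U w hw => exponentMeasure_outside_ne_top hσ U hw) hbox s z hz',
      exponentMeasure_exists_le_inter_lt hσ t hy s hz', rescaledKernel_forall_lt hσ t hy s hz']
  -- If some `z i = 0`, the exponential is `e^{-∞} = 0`, and the left side vanishes because the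
  -- conditional law is carried by nonnegative functions.
  · push Not at hz'
    obtain ⟨i, hi⟩ := hz'
    have hi0 : z i = 0 := le_antisymm hi (hz i)
    rw [lintegral_iSup_div_sub_eq_top hσ t hy s hi0, expNeg_top, zero_mul]
    have hsub : {g : C(T, ℝ) | ∀ i, g (s i) < z i} ⊆ {g | 0 ≤ g}ᶜ := fun g hg hg0 =>
      absurd (hg0 (s i)) (not_le.2 ((hg i).trans_eq hi0))
    exact measure_mono_null hsub hnn

end Conditioning

end

theorem proposition4p2 {T Ω : Type*} [MetricSpace T] [CompactSpace T] [Nonempty T]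
    [MeasurableSpace Ω] (P : Measure Ω) [IsProbabilityMeasure P]
    (η : Ω → C(T, ℝ)) (σ : Measure (PosFun T)) (Φ : Ω → Measure (PosFun T))
    (hη : IsMaxStableFieldWith η σ Φ P) (t : T) :
    -- the `t`-extremal function and the kernel `P_t` exist
    (∃ φ : Ω → PosFun T, IsExtremalFunction φ Φ t P) ∧
    (∃ κ : Kernel ℝ (PosFun T), IsConditionalMeasure κ (exponentMeasure σ) t) ∧
    -- the conditional law of the `t`-extremal function given `η(t) = y`
    (∀ (φ : Ω → PosFun T) (κ : Kernel ℝ (PosFun T)), IsExtremalFunction φ Φ t P →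
      IsConditionalMeasure κ (exponentMeasure σ) t →
      ∀ᵐ y ∂(P.map (fun ω => η ω t)),
        condDistrib φ (fun ω => η ω t) P y = κ y ∧
        ∀ A : Set (PosFun T), MeasurableSet A →
          κ y A = ∫⁻ f, A.indicator 1 (PosFun.scale (y / f.1 t) f) * ENNReal.ofReal (f.1 t) ∂σ) ∧
    -- the conditional distribution function of `η` given `η(t) = y`; here `a / 0 = ∞` for `a > 0`,
    -- and the subtraction in `ℝ≥0∞` is the positive part of the difference
    (∀ᵐ y ∂(P.map (fun ω => η ω t)),
      ∀ (l : ℕ) (s : Fin l → T) (z : Fin l → ℝ), (∀ i, 0 ≤ z i) →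
        condDistrib η (fun ω => η ω t) P y {g : C(T, ℝ) | ∀ i, g (s i) < z i} =
          EReal.exp (-((∫⁻ f, ((⨆ i, ENNReal.ofReal (f.1 (s i)) / ENNReal.ofReal (z i)) -
              ENNReal.ofReal (f.1 t) / ENNReal.ofReal y) ∂σ : ℝ≥0∞) : EReal)) *
          ∫⁻ f, {f : PosFun T | (⨆ i, ENNReal.ofReal (f.1 (s i)) / ENNReal.ofReal (z i)) <
              ENNReal.ofReal (f.1 t) / ENNReal.ofReal y}.indicator
                (fun f => ENNReal.ofReal (f.1 t)) f ∂σ) := by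
  have := hη.spectral.prob
  have hκ := isConditionalMeasure_rescaledKernel hη.spectral t
  refine ⟨exists_isExtremalFunction hη.spectral hη.poisson hη.pointMeasure t, ⟨_, hκ⟩,
    fun φ κ hφ hκ' => ?_, condDistrib_lt_ae_eq hη t⟩
  -- The given kernel and the explicit one both agree almost everywhere with the same conditional
  -- distribution; this identifies them with no separate uniqueness argument for disintegrations.
  filter_upwards [condDistrib_extremal_ae_eq hη hφ hκ, condDistrib_extremal_ae_eq hη hφ hκ']
    with y h1 h2
  refine ⟨h2, fun A hA => ?_⟩
  rw [← h2, h1, rescaledKernel_apply σ t y hA]
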